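/- For $n\ge 1$ let $\mathsf{MajIx}_n$ be the following partial Boolean function. Alice's input is a string $x\in\{0,1\}^n$, Bob's input is a set $I\subseteq\{1,\dots,n\}$ with $|I|=k:=\lfloor\sqrt n\rfloor$ (so $k=\sqrt n$ when $n$ is a perfect square), and $$\mathsf{MajIx}_n(x,I)=\begin{cases}1 & \text{if } |\{i\in I: x_i=1\}|=k,\\ 0 & \text{if } |\{i\in I: x_i=1\}|\le 0.9\,k,\\ \text{undefined} & \text{otherwise.}\end{cases}$$ In a one-way QMA protocol (without entanglement) for a partial Boolean function $f$, Merlin sends Alice a quantum proof, i.e. an arbitrary (mixed) state of $p$ qubits; Alice applies to it a quantum operation depending on her input $x$ and sends the resulting $a$ qubits to Bob; Bob performs a two-outcome measurement depending on his input $y$ and accepts or rejects. The protocol is correct if for every $(x,y)$ with $f(x,y)=1$ some proof makes Bob accept with probability at least $2/3$, and for every $(x,y)$ with $f(x,y)=0$ Bob rejects every proof with probability at least $2/3$; nothing is required where $f$ is undefined. Its cost is $p+a$, and $QMA^{A\to B}(f)$ is the minimum cost of a correct protocol. In a one-way QCMA protocol with entanglement, Alice and Bob share beforehand an arbitrary bipartite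 state, of arbitrary finite dimension and independent of the inputs and the proof; Merlin sends Alice a classical proof of $p$ bits; Alice applies to her half of the shared state a quantum operation depending on $x$ and the proof, and sends the resulting $a$ qubits to Bob, who performs a two-outcome measurement, depending on $y$, on these qubits and his half of the shared state. Correctness (with classical proofs) and the cost $p+a$ are defined in the same way, and $QCMA^{A\to B,*}(f)$ is the minimum cost of a correct protocol. Then $QMA^{A\to B}(\mathsf{MajIx}_n)=O(\log n)$, while $QCMA^{A\to B,*}(\mathsf{MajIx}_n)=\Omega(\sqrt n/\log n)$. That is, there are constants $C,c>0$ such that for all $n\ge 2$ $$QMA^{A\to B}(\mathsf{MajIx}_n)\le C\log n\qquad\text{and}\qquad QCMA^{A\to B,*}(\mathsf{MajIx}_n)\ge c\,\frac{\sqrt n}{\log n}.$$ -/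

import Mathlib

open scoped Matrix Kronecker ENNReal ComplexOrder

noncomputable section

namespace OneWay

/-- The computational basis of a register of `k` qubits: the bit strings of length `k`. -/
abbrev Qubits (k : ℕ) : Type := Fin k → Bool

/-- A quantum state (density matrix) on the finite-dimensional Hilbert space with orthonormal
basis `ι`. -/
structure DensityMatrix (ι : Type) [Fintype ι] where
  mat : Matrix ι ι ℂ
  posSemidef : mat.PosSemidef
  trace_eq_one : mat.trace = 1

/-- A quantum operation (completely positive trace-preserving map) from the space with basis `ι`
to the space with basis `κ`, presented by Kraus operators. -/
structure Channel (ι κ : Type) [DecidableEq ι] [Fintype κ] where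
  num : ℕ
  kraus : Fin num → Matrix κ ι ℂ
  sum_eq_one : ∑ i, (kraus i)ᴴ * kraus i = 1

/-- A two-outcome measurement (POVM), given by the operator `0 ≤ mat ≤ 1` of the outcome
"accept". -/
structure Effect (ι : Type) [DecidableEq ι] where
  mat : Matrix ι ι ℂ
  posSemidef : mat.PosSemidef
  posSemidef_one_sub : (1 - mat).PosSemidef

/-- The action of a quantum operation on states, `ρ ↦ ∑ i, Kᵢ ρ Kᵢᴴ`. -/
def Channel.apply {ι κ : Type} [Fintype ι] [DecidableEq ι] [Fintype κ]
    (Φ : Channel ι κ) (ρ : DensityMatrix ι) : DensityMatrix κ where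
  mat := ∑ i, Φ.kraus i * ρ.mat * (Φ.kraus i)ᴴ
  posSemidef := Matrix.posSemidef_sum _ fun i _ => ρ.posSemidef.mul_mul_conjTranspose_same _
  trace_eq_one := by
    have h : ∀ i, (Φ.kraus i * ρ.mat * (Φ.kraus i)ᴴ).trace
        = ((Φ.kraus i)ᴴ * Φ.kraus i * ρ.mat).trace := fun i => by
      rw [Matrix.trace_mul_comm, Matrix.mul_assoc]
    rw [Matrix.trace_sum, Finset.sum_congr rfl fun i _ => h i, ← Matrix.trace_sum,
      ← Finset.sum_mul, Φ.sum_eq_one, Matrix.one_mul, ρ.trace_eq_one]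

/-- The quantum operation `Φ ⊗ id`, acting on the first half of a bipartite system. -/
def Channel.tensorId {ι κ : Type} [DecidableEq ι] [Fintype κ] (Φ : Channel ι κ)
    (β : Type) [Fintype β] [DecidableEq β] : Channel (ι × β) (κ × β) where
  num := Φ.num
  kraus i := Φ.kraus i ⊗ₖ (1 : Matrix β β ℂ)
  sum_eq_one := by
    have h : ∀ i, (Φ.kraus i ⊗ₖ (1 : Matrix β β ℂ))ᴴ * (Φ.kraus i ⊗ₖ (1 : Matrix β β ℂ))
        = ((Φ.kraus i)ᴴ * Φ.kraus i) ⊗ₖ (1 : Matrix β β ℂ) := fun i => by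
      rw [Matrix.conjTranspose_kronecker, ← Matrix.mul_kronecker_mul, Matrix.conjTranspose_one,
        Matrix.one_mul]
    rw [Finset.sum_congr rfl fun i _ => h i, ← Matrix.one_kronecker_one, ← Φ.sum_eq_one]
    ext a b
    simp [Matrix.sum_apply, Matrix.kroneckerMap_apply, Finset.sum_mul]

/-- The probability `Tr (E ρ)` that the measurement `E` accepts the state `ρ`. -/
def Effect.prob {ι : Type} [Fintype ι] [DecidableEq ι] (E : Effect ι) (ρ : DensityMatrix ι) : ℝ :=
  (E.mat * ρ.mat).trace.re

/-- A one-way QMA protocol without prior entanglement. Merlin sends Alice a quantum proof of `p`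
qubits; Alice, depending on her input `x`, turns it into a message of `a` qubits for Bob; Bob,
depending on his input `y`, measures the message and accepts or rejects. Nothing else (not even a
random coin) is shared between Alice and Bob. -/
structure QMAProtocol (X Y : Type) (p a : ℕ) where
  alice : X → Channel (Qubits p) (Qubits a)
  bob : Y → Effect (Qubits a)

/-- The probability that Bob accepts on input `(x, y)` when Merlin sends the proof `π`. -/
def QMAProtocol.acceptProb {X Y : Type} {p a : ℕ} (P : QMAProtocol X Y p a)
    (x : X) (y : Y) (π : DensityMatrix (Qubits p)) : ℝ :=
  (P.bob y).prob ((P.alice x).apply π)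

/-- The protocol is correct for the partial function `f` (the value `none` means "undefined"):
on every 1-input some quantum proof is accepted with probability at least `2/3`, on every 0-input
all quantum proofs are rejected with probability at least `2/3`. -/
def QMAProtocol.Computes {X Y : Type} {p a : ℕ} (P : QMAProtocol X Y p a)
    (f : X → Y → Option Bool) : Prop :=
  ∀ x y,
    (f x y = some true → ∃ π, 2 / 3 ≤ P.acceptProb x y π) ∧
    (f x y = some false → ∀ π, 2 / 3 ≤ 1 - P.acceptProb x y π)

/-- `QMA^{A→B}(f)`: the least total length (proof plus message, in qubits) of a one-way QMA
protocol without entanglement for `f`. -/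
def qmaComplexity {X Y : Type} (f : X → Y → Option Bool) : ℕ∞ :=
  ⨅ (p : ℕ) (a : ℕ) (P : QMAProtocol X Y p a) (_ : P.Computes f), ((p + a : ℕ) : ℕ∞)

/-- A one-way QCMA protocol with prior entanglement. Alice and Bob share an arbitrary bipartite
state, independent of the inputs and of the proof, on finite-dimensional spaces of arbitrary
dimensions `dimA` and `dimB` (so they may also share a random coin). Merlin sends Alice a classical
proof of `p` bits; Alice, depending on her input and the proof, applies a quantum operation to her
half of the shared state, producing a message of `a` qubits for Bob; Bob, depending on his input,
measures the message jointly with his half of the shared state, and accepts or rejects. -/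
structure QCMAProtocol (X Y : Type) (p a : ℕ) where
  dimA : ℕ
  dimB : ℕ
  shared : DensityMatrix (Fin dimA × Fin dimB)
  alice : X → (Fin p → Bool) → Channel (Fin dimA) (Qubits a)
  bob : Y → Effect (Qubits a × Fin dimB)

/-- The probability that Bob accepts on input `(x, y)` when Merlin sends the proof `w`. -/
def QCMAProtocol.acceptProb {X Y : Type} {p a : ℕ} (P : QCMAProtocol X Y p a)
    (x : X) (y : Y) (w : Fin p → Bool) : ℝ :=
  (P.bob y).prob (((P.alice x w).tensorId (Fin P.dimB)).apply P.shared)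

/-- The protocol is correct for the partial function `f`: on every 1-input some classical proof is
accepted with probability at least `2/3`, on every 0-input all classical proofs are rejected with
probability at least `2/3`. -/
def QCMAProtocol.Computes {X Y : Type} {p a : ℕ} (P : QCMAProtocol X Y p a)
    (f : X → Y → Option Bool) : Prop :=
  ∀ x y,
    (f x y = some true → ∃ w, 2 / 3 ≤ P.acceptProb x y w) ∧
    (f x y = some false → ∀ w, 2 / 3 ≤ 1 - P.acceptProb x y w)

/-- `QCMA^{A→B,*}(f)`: the least total length (bits of the proof plus qubits of the message) of a
one-way QCMA protocol with entanglement for `f`. -/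
def qcmaEntComplexity {X Y : Type} (f : X → Y → Option Bool) : ℕ∞ :=
  ⨅ (p : ℕ) (a : ℕ) (P : QCMAProtocol X Y p a) (_ : P.Computes f), ((p + a : ℕ) : ℕ∞)

/-- The partial Boolean function `MajIx` on `n`-bit strings `x` (Alice) and sets `I` of `√n`
indices (Bob). The value is `1` if `x i = 1` for all `√n` indices `i ∈ I`, it is `0` if `x i = 1`
for at most `0.9 √n` of them, and it is undefined otherwise. If `n` is not a perfect square, `√n`
is rounded down. -/
def majIx (n : ℕ) (x : Fin n → Bool) (I : {I : Finset (Fin n) // I.card = Nat.sqrt n}) :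
    Option Bool :=
  if (I.1.filter fun i => x i = true).card = Nat.sqrt n then some true
  else if 10 * (I.1.filter fun i => x i = true).card ≤ 9 * Nat.sqrt n then some false
  else none

end OneWay

end

/-! Upper bound. Merlin sends eleven copies of the uniform superposition over `I`, Alice projects
onto tuples of indices where `x` is `1`, Bob projects onto the uniform superposition of tuples from
`I`. Bob's projector compressed by Alice's is a rank-one projector scaled by the fraction of
surviving tuples (`uniformEffect_prob_filterChannel`), so no proof, even entangled across the
copies, exceeds `(9/10) ^ 11 < 1/3` on a 0-input.

Lower bound. A short message leaves few classically distinct behaviours of Bob. Alice cannot change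
Bob's marginal, so all his possible states are at most `4 ^ a` times one fixed state
(`tensorId_apply_le`), hence have relative entropy `O(a + 1)` to a fixed full-rank `τ`. Take as
hypothesis a near-minimizer of relative entropy to `τ` under the constraints recorded so far; any
state satisfying a further constraint that the hypothesis violates has relative entropy larger by a
constant (`relEnt_midpoint_add_le`, from a Pinsker-type inequality). So `O(a + 1)` recorded pairs
(set, bit) determine the outcome on all sets outside the promise gap, and `(2 * N + 1) ^ O(a + 1)`
functions `g` serve all inputs and proofs, where `N` is the number of sets Bob may hold
(`exists_hypotheses`).

Let `k = Nat.sqrt n` and suppose `p < k`. For `x` with at least `n / 2` ones, a single proof works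
for a `2 ^ -p` fraction of the `k`-sets of ones; the corresponding `g` accepts these, and accepts
only sets with at least 9/10 of their elements ones of `x`. From `g` alone one extracts a core `T`
(`exists_core`): each accepted set has more than half of its elements in `T`, and at least 4/5 of
`T` are ones of `x`. The first property forces `n ≤ 32 * T.card`, as a smaller `T` captures most of
only a `2 ^ -k` fraction of the `k`-sets. The second then holds, by a Chernoff bound, for at most a
`(5/6) ^ (n/32)` fraction of all strings. Hence exponentially many `g` are needed, and `n = O((a +
1) √n log n)`. If `p ≥ k`, the bound is immediate. -/

noncomputable section

namespace OneWay

open Matrix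

/-! ### Spectral calculus and quantum relative entropy -/

section Spectral

variable {ι : Type} [Fintype ι] [DecidableEq ι]

/-- The unitary matrix whose columns are an eigenbasis. -/
def eigU {A : Matrix ι ι ℂ} (hA : A.IsHermitian) : Matrix ι ι ℂ := hA.eigenvectorUnitary

/-- The functional calculus of a Hermitian matrix, in its eigenbasis. -/
def specFun {A : Matrix ι ι ℂ} (hA : A.IsHermitian) (f : ℝ → ℝ) : Matrix ι ι ℂ :=
  eigU hA * diagonal (fun i => ((f (hA.eigenvalues i) : ℝ) : ℂ)) *
    (eigU hA)ᴴ

theorem conjTranspose_eigU_mul {A : Matrix ι ι ℂ} (hA : A.IsHermitian) :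
    (eigU hA)ᴴ * eigU hA = 1 :=
  (Matrix.mem_unitaryGroup_iff').mp hA.eigenvectorUnitary.2

theorem eigU_mul_conjTranspose {A : Matrix ι ι ℂ} (hA : A.IsHermitian) :
    eigU hA * (eigU hA)ᴴ = 1 :=
  (Matrix.mem_unitaryGroup_iff).mp hA.eigenvectorUnitary.2

theorem eq_eigU_mul_diagonal {A : Matrix ι ι ℂ} (hA : A.IsHermitian) :
    A = eigU hA * diagonal (fun i => ((hA.eigenvalues i : ℝ) : ℂ)) * (eigU hA)ᴴ := by
  conv_lhs => rw [hA.spectral_theorem]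
  rw [Unitary.conjStarAlgAut_apply]
  rfl

theorem specFun_id {A : Matrix ι ι ℂ} (hA : A.IsHermitian) : specFun hA id = A := by
  exact (eq_eigU_mul_diagonal hA).symm

/-- The overlaps `|⟨uᵢ, vⱼ⟩|²` of the eigenbases of two Hermitian matrices. -/
def overlap {A B : Matrix ι ι ℂ} (hA : A.IsHermitian) (hB : B.IsHermitian) (i j : ι) : ℝ :=
  Complex.normSq (((eigU hA)ᴴ * eigU hB) i j)

theorem overlap_nonneg {A B : Matrix ι ι ℂ} (hA : A.IsHermitian) (hB : B.IsHermitian) (i j : ι) :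
    0 ≤ overlap hA hB i j := Complex.normSq_nonneg _

theorem mul_diagonal_mul_conjTranspose_apply {κ : Type} (X : Matrix κ ι ℂ) (a : ι → ℝ) (k : κ) :
    (X * diagonal (fun i => (a i : ℂ)) * Xᴴ) k k =
      ((∑ i, a i * Complex.normSq (X k i) : ℝ) : ℂ) := by
  rw [Matrix.mul_apply, Complex.ofReal_sum]
  refine Finset.sum_congr rfl fun i _ => ?_
  rw [Matrix.mul_diagonal, Matrix.conjTranspose_apply, Complex.ofReal_mul, ← Complex.mul_conj,
    starRingEnd_apply]
  ring

theorem overlap_sum_right {A B : Matrix ι ι ℂ} (hA : A.IsHermitian) (hB : B.IsHermitian) (i : ι) :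
    ∑ j, overlap hA hB i j = 1 := by
  have h := mul_diagonal_mul_conjTranspose_apply
    ((eigU hA)ᴴ * eigU hB) (fun _ => 1) i
  have e : (eigU hA)ᴴ * eigU hB *
      diagonal (fun _ => ((1 : ℝ) : ℂ)) *
      ((eigU hA)ᴴ * eigU hB)ᴴ = 1 := by
    rw [Complex.ofReal_one, Matrix.diagonal_one, Matrix.mul_one, Matrix.conjTranspose_mul,
      Matrix.conjTranspose_conjTranspose, Matrix.mul_assoc, ← Matrix.mul_assoc (eigU hB),
      eigU_mul_conjTranspose, Matrix.one_mul, conjTranspose_eigU_mul]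
  rw [e, Matrix.one_apply_eq] at h
  simp only [one_mul] at h
  exact_mod_cast h.symm

theorem overlap_comm {A B : Matrix ι ι ℂ} (hA : A.IsHermitian) (hB : B.IsHermitian) (i j : ι) :
    overlap hA hB i j = overlap hB hA j i := by
  unfold overlap
  rw [← Complex.normSq_conj, starRingEnd_apply, ← Matrix.conjTranspose_apply,
    Matrix.conjTranspose_mul, Matrix.conjTranspose_conjTranspose]

/-- The overlaps form a doubly stochastic matrix, so traces of two non-commuting matrices become
classical double sums over pairs of eigenvalues; scalar inequalities then apply termwise. -/
theorem trace_specFun_mul_specFun {A B : Matrix ι ι ℂ} (hA : A.IsHermitian) (hB : B.IsHermitian)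
    (f g : ℝ → ℝ) : (specFun hA f * specFun hB g).trace.re =
      ∑ i, ∑ j, f (hA.eigenvalues i) * g (hB.eigenvalues j) * overlap hA hB i j := by
  set U : Matrix ι ι ℂ := eigU hA with hU
  set V : Matrix ι ι ℂ := eigU hB with hV
  have e : (specFun hA f * specFun hB g).trace =
      (diagonal (fun i => ((f (hA.eigenvalues i) : ℝ) : ℂ)) *
        ((Uᴴ * V) * diagonal (fun j => ((g (hB.eigenvalues j) : ℝ) : ℂ)) * (Uᴴ * V)ᴴ)).trace := by
    unfold specFun
    rw [← hU, ← hV, Matrix.mul_assoc U, Matrix.mul_assoc U, Matrix.trace_mul_comm U,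
      Matrix.conjTranspose_mul, Matrix.conjTranspose_conjTranspose]
    simp only [Matrix.mul_assoc]
  rw [e, Matrix.trace, Complex.re_sum]
  refine Finset.sum_congr rfl fun i _ => ?_
  rw [Matrix.diag_apply, Matrix.diagonal_mul, mul_diagonal_mul_conjTranspose_apply,
    Complex.re_ofReal_mul, Complex.ofReal_re, Finset.mul_sum]
  refine Finset.sum_congr rfl fun j _ => ?_
  unfold overlap
  rw [← hU, ← hV, mul_assoc]

theorem trace_mul_specFun {A B : Matrix ι ι ℂ} (hA : A.IsHermitian) (hB : B.IsHermitian)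
    (g : ℝ → ℝ) : (A * specFun hB g).trace.re =
      ∑ i, ∑ j, hA.eigenvalues i * g (hB.eigenvalues j) * overlap hA hB i j := by
  have h := trace_specFun_mul_specFun hA hB id g
  rwa [specFun_id] at h

theorem trace_mul_re_nonneg {A B : Matrix ι ι ℂ} (hA : A.PosSemidef) (hB : B.PosSemidef) :
    0 ≤ (A * B).trace.re := by
  have h := trace_mul_specFun hA.isHermitian hB.isHermitian id
  rw [specFun_id] at h
  rw [h]
  exact Finset.sum_nonneg fun i _ => Finset.sum_nonneg fun j _ =>
    mul_nonneg (mul_nonneg (hA.eigenvalues_nonneg i) (hB.eigenvalues_nonneg j))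
      (overlap_nonneg _ _ _ _)

theorem trace_re_eq_sum_left {A B : Matrix ι ι ℂ} (hA : A.IsHermitian) (hB : B.IsHermitian) :
    A.trace.re = ∑ i, ∑ j, hA.eigenvalues i * overlap hA hB i j := by
  rw [hA.trace_eq_sum_eigenvalues, Complex.re_sum]
  refine Finset.sum_congr rfl fun i _ => ?_
  rw [← Finset.mul_sum, overlap_sum_right, mul_one]
  exact Complex.ofReal_re _

theorem trace_re_eq_sum_right {A B : Matrix ι ι ℂ} (hA : A.IsHermitian) (hB : B.IsHermitian) :
    B.trace.re = ∑ i, ∑ j, hB.eigenvalues j * overlap hA hB i j := by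
  rw [Finset.sum_comm, trace_re_eq_sum_left hB hA]
  simp_rw [overlap_comm hA hB]

/-- The negative of the von Neumann entropy. -/
def negEntropy {A : Matrix ι ι ℂ} (hA : A.IsHermitian) : ℝ :=
  ∑ i, hA.eigenvalues i * Real.log (hA.eigenvalues i)

/-- The quantum relative entropy `Tr A log A - Tr A log B`. -/
def relEntropy {A B : Matrix ι ι ℂ} (hA : A.IsHermitian) (hB : B.IsHermitian) : ℝ :=
  negEntropy hA - (A * specFun hB Real.log).trace.re

theorem negEntropy_eq_trace {A : Matrix ι ι ℂ} (hA : A.IsHermitian) :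
    negEntropy hA = (A * specFun hA Real.log).trace.re := by
  have e : A * specFun hA Real.log = specFun hA (fun t => t * Real.log t) := by
    refine (congrArg (· * specFun hA Real.log) (eq_eigU_mul_diagonal hA)).trans ?_
    unfold specFun
    simp only [Matrix.mul_assoc]
    rw [← Matrix.mul_assoc _ᴴ (eigU hA), conjTranspose_eigU_mul,
      Matrix.one_mul, ← Matrix.mul_assoc (diagonal _), Matrix.diagonal_mul_diagonal]
    simp
  rw [e, specFun, Matrix.mul_assoc, Matrix.trace_mul_comm, Matrix.mul_assoc,
    conjTranspose_eigU_mul, Matrix.mul_one, Matrix.trace_diagonal, Complex.re_sum]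
  rfl

theorem relEntropy_eq_sum {A B : Matrix ι ι ℂ} (hA : A.IsHermitian) (hB : B.IsHermitian) :
    relEntropy hA hB = ∑ i, ∑ j, overlap hA hB i j *
      (hA.eigenvalues i * Real.log (hA.eigenvalues i) -
        hA.eigenvalues i * Real.log (hB.eigenvalues j)) := by
  have h : negEntropy hA = ∑ i, ∑ j, overlap hA hB i j *
      (hA.eigenvalues i * Real.log (hA.eigenvalues i)) := by
    refine Finset.sum_congr rfl fun i _ => ?_
    rw [← Finset.sum_mul, overlap_sum_right, one_mul]
  rw [relEntropy, h, trace_mul_specFun hA hB, ← Finset.sum_sub_distrib]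
  refine Finset.sum_congr rfl fun i _ => ?_
  rw [← Finset.sum_sub_distrib]
  refine Finset.sum_congr rfl fun j _ => ?_
  ring

/-- Evaluate `c • B - A` at the `j`-th eigenvector of `B` and keep one term of the expansion of `A`.
It serves as the support condition: the left side vanishes when the eigenvalue of `B` does. -/
theorem sum_eigenvalues_mul_overlap_le {A B : Matrix ι ι ℂ} (hA : A.PosSemidef)
    (hB : B.IsHermitian) {c : ℝ} (h : ((c : ℂ) • B - A).PosSemidef) (i j : ι) :
    hA.isHermitian.eigenvalues i * overlap hA.isHermitian hB i j ≤ c * hB.eigenvalues j := by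
  set U : Matrix ι ι ℂ := eigU hA.isHermitian with hU
  set V : Matrix ι ι ℂ := eigU hB with hV
  have h1 := (h.conjTranspose_mul_mul_same V).diag_nonneg (i := j)
  have eB : Vᴴ * B * V = diagonal (fun j => ((hB.eigenvalues j : ℝ) : ℂ)) := by
    conv_lhs => rw [← specFun_id hB]
    unfold specFun
    rw [← hV]
    simp only [Matrix.mul_assoc]
    rw [conjTranspose_eigU_mul, Matrix.mul_one, ← Matrix.mul_assoc, conjTranspose_eigU_mul,
      Matrix.one_mul]
    rfl
  have eA : Vᴴ * A * V = (Vᴴ * U) * diagonal (fun i => ((hA.isHermitian.eigenvalues i : ℝ) : ℂ)) *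
      (Vᴴ * U)ᴴ := by
    conv_lhs => rw [← specFun_id hA.isHermitian]
    unfold specFun
    rw [← hU, Matrix.conjTranspose_mul, Matrix.conjTranspose_conjTranspose]
    simp only [Matrix.mul_assoc, id]
  rw [Matrix.mul_sub, Matrix.sub_mul, Matrix.mul_smul, Matrix.smul_mul, eB, eA, Matrix.sub_apply,
    Matrix.smul_apply, Matrix.diagonal_apply_eq, mul_diagonal_mul_conjTranspose_apply,
    smul_eq_mul, ← Complex.ofReal_mul, ← Complex.ofReal_sub] at h1
  have h2 : 0 ≤ c * hB.eigenvalues j - ∑ i, hA.isHermitian.eigenvalues i *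
      Complex.normSq ((Vᴴ * U) j i) := by exact_mod_cast h1
  have h3 : hA.isHermitian.eigenvalues i * Complex.normSq ((Vᴴ * U) j i) ≤
      ∑ i, hA.isHermitian.eigenvalues i * Complex.normSq ((Vᴴ * U) j i) :=
    Finset.single_le_sum (f := fun i => hA.isHermitian.eigenvalues i *
      Complex.normSq ((Vᴴ * U) j i))
      (fun i _ => mul_nonneg (hA.eigenvalues_nonneg i) (Complex.normSq_nonneg _))
      (Finset.mem_univ i)
  rw [overlap_comm]
  change _ * Complex.normSq ((Vᴴ * U) j i) ≤ _
  linarith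

/-- This is `log t ≤ t - 1` at `t = √b / √a`, multiplied by `2 * a`: the scalar form of "squared
Hellinger distance is at most relative entropy". -/
theorem sq_sqrt_sub_sqrt_le {a b : ℝ} (ha : 0 ≤ a) (hb : 0 < b) :
    (√a - √b) ^ 2 ≤ a * Real.log a - a * Real.log b - a + b := by
  rcases ha.eq_or_lt with rfl | ha
  · simp [Real.sq_sqrt hb.le]
  have h := Real.log_le_sub_one_of_pos (x := √b / √a) (by positivity)
  rw [Real.log_div (by positivity) (by positivity), Real.log_sqrt hb.le, Real.log_sqrt ha.le] at h
  have h2 : a * (√b / √a) = √a * √b := by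
    have : √a ≠ 0 := by positivity
    field_simp
    nlinarith [Real.sq_sqrt ha.le]
  nlinarith [Real.sq_sqrt ha.le, Real.sq_sqrt hb.le, mul_le_mul_of_nonneg_left h ha.le]

theorem Effect.posSemidef_sub_sq (E : Effect ι) : (E.mat - E.mat * E.mat).PosSemidef := by
  have h1 := E.posSemidef_one_sub.mul_mul_conjTranspose_same E.mat
  have h2 := E.posSemidef.mul_mul_conjTranspose_same (1 - E.mat)
  rw [E.posSemidef.isHermitian.eq] at h1
  rw [E.posSemidef_one_sub.isHermitian.eq] at h2
  convert h1.add h2 using 1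
  noncomm_ring

theorem Effect.trace_mul_mul_le (E : Effect ι) {A : Matrix ι ι ℂ} (hA : A.PosSemidef) :
    (E.mat * A * E.mat).trace.re ≤ A.trace.re := by
  have h1 := trace_mul_re_nonneg E.posSemidef_sub_sq hA
  have h2 := trace_mul_re_nonneg E.posSemidef_one_sub hA
  rw [Matrix.sub_mul, Matrix.trace_sub, Complex.sub_re] at h1 h2
  rw [Matrix.trace_mul_comm, ← Matrix.mul_assoc]
  rw [Matrix.one_mul] at h2
  linarith

theorem trace_mul_diagonal_mul_conjTranspose (X : Matrix ι ι ℂ) (a : ι → ℝ) :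
    (X * diagonal (fun i => (a i : ℂ)) * Xᴴ).trace.re =
      ∑ i, ∑ j, a i * Complex.normSq (X j i) := by
  rw [Matrix.trace, Complex.re_sum, Finset.sum_comm]
  refine Finset.sum_congr rfl fun i _ => ?_
  rw [Matrix.diag_apply, mul_diagonal_mul_conjTranspose_apply, Complex.ofReal_re]

/-- A Pinsker-type inequality for the quantum relative entropy. -/
theorem sq_trace_effect_le_relEntropy (E : Effect ι) {A B : Matrix ι ι ℂ} (hA : A.PosSemidef)
    (hB : B.PosSemidef) (hA1 : A.trace.re = 1) (hB1 : B.trace.re = 1) {c : ℝ}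
    (h : ((c : ℂ) • B - A).PosSemidef) :
    ((E.mat * A).trace.re - (E.mat * B).trace.re) ^ 2 ≤
      4 * relEntropy hA.isHermitian hB.isHermitian := by
  set U : Matrix ι ι ℂ := eigU hA.isHermitian with hU
  set V : Matrix ι ι ℂ := eigU hB.isHermitian with hV
  set a := hA.isHermitian.eigenvalues with ha
  set b := hB.isHermitian.eigenvalues with hb
  set o := overlap hA.isHermitian hB.isHermitian with ho
  have ha0 : ∀ i, 0 ≤ a i := hA.eigenvalues_nonneg
  have hb0 : ∀ i, 0 ≤ b i := hB.eigenvalues_nonneg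
  have eA : A = U * diagonal (fun i => ((a i : ℝ) : ℂ)) * Uᴴ := (specFun_id hA.isHermitian).symm
  have eB : B = V * diagonal (fun i => ((b i : ℝ) : ℂ)) * Vᴴ := (specFun_id hB.isHermitian).symm
  have hUU : U * Uᴴ = 1 := eigU_mul_conjTranspose _
  have hVV : V * Vᴴ = 1 := eigU_mul_conjTranspose _
  have hS : ∑ i, ∑ j, o i j * (√(a i) - √(b j)) ^ 2 ≤
      relEntropy hA.isHermitian hB.isHermitian := by
    have e0 : ∑ i, ∑ j, o i j * (a i - b j) = 0 := by
      have h1 := trace_re_eq_sum_left hA.isHermitian hB.isHermitian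
      have h2 := trace_re_eq_sum_right hA.isHermitian hB.isHermitian
      rw [hA1] at h1
      rw [hB1] at h2
      calc _ = ∑ i, ∑ j, (a i * o i j - b j * o i j) :=
            Finset.sum_congr rfl fun i _ => Finset.sum_congr rfl fun j _ => by ring
        _ = 0 := by
            simp_rw [Finset.sum_sub_distrib]
            linarith
    suffices hs : (∑ i, ∑ j, o i j * (√(a i) - √(b j)) ^ 2) + ∑ i, ∑ j, o i j * (a i - b j) ≤
        relEntropy hA.isHermitian hB.isHermitian by rwa [e0, add_zero] at hs
    rw [relEntropy_eq_sum, ← Finset.sum_add_distrib]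
    refine Finset.sum_le_sum fun i _ => ?_
    rw [← Finset.sum_add_distrib]
    refine Finset.sum_le_sum fun j _ => ?_
    rw [← mul_add]
    rcases (hb0 j).eq_or_lt with hj | hj
    -- Since `Real.log 0 = 0`, the scalar bound can fail at `b j = 0`; domination by `c • B` makes
    -- the term vanish there.
    · have h1 := sum_eigenvalues_mul_overlap_le hA hB.isHermitian h i j
      change a i * o i j ≤ c * b j at h1
      rw [← hj, mul_zero] at h1
      have h2 : 0 ≤ o i j := overlap_nonneg _ _ _ _
      have h3 : a i * o i j = 0 := le_antisymm h1 (mul_nonneg (ha0 i) h2)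
      rcases mul_eq_zero.mp h3 with h4 | h4
      · simp [← ha, ← hb, ← hj, h4]
      · simp [← ho, h4]
    · refine mul_le_mul_of_nonneg_left ?_ (overlap_nonneg _ _ _ _)
      have := sq_sqrt_sub_sqrt_le (ha0 i) hj
      change _ ≤ a i * Real.log (a i) - a i * Real.log (b j)
      linarith
  set F := Vᴴ * E.mat * U with hF
  set C := Uᴴ * V with hC
  have hE : E.matᴴ = E.mat := E.posSemidef.isHermitian.eq
  have hFa : ∑ i, ∑ j, a i * Complex.normSq (F j i) ≤ 1 := by
    rw [← trace_mul_diagonal_mul_conjTranspose, ← hA1]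
    refine le_trans (le_of_eq ?_) (E.trace_mul_mul_le hA)
    congr 1
    conv_rhs => rw [eA]
    rw [hF]
    simp only [Matrix.conjTranspose_mul, Matrix.conjTranspose_conjTranspose, hE, Matrix.mul_assoc]
    rw [Matrix.trace_mul_comm]
    simp only [Matrix.mul_assoc, hVV, Matrix.mul_one]
  have hFb : ∑ j, ∑ i, b j * Complex.normSq (F j i) ≤ 1 := by
    have e : ∀ i j, Complex.normSq (F j i) = Complex.normSq (Fᴴ i j) := fun i j => by
      rw [Matrix.conjTranspose_apply, ← starRingEnd_apply, Complex.normSq_conj]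
    simp_rw [e]
    rw [← trace_mul_diagonal_mul_conjTranspose, ← hB1]
    refine le_trans (le_of_eq ?_) (E.trace_mul_mul_le hB)
    congr 1
    conv_rhs => rw [eB]
    rw [hF]
    simp only [Matrix.conjTranspose_mul, Matrix.conjTranspose_conjTranspose, hE, Matrix.mul_assoc]
    rw [Matrix.trace_mul_comm]
    simp only [Matrix.mul_assoc, hUU, Matrix.mul_one]
  have hT : (E.mat * A).trace - (E.mat * B).trace =
      ∑ j, ∑ i, F j i * (((a i - b j : ℝ) : ℂ) * C i j) := by
    have e1 : (E.mat * A).trace = (F * (diagonal (fun i => ((a i : ℝ) : ℂ)) * C)).trace := by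
      conv_lhs => rw [eA]
      rw [hF, hC]
      simp only [Matrix.mul_assoc]
      rw [Matrix.trace_mul_comm Vᴴ]
      simp only [Matrix.mul_assoc, hVV, Matrix.mul_one]
    have e2 : (E.mat * B).trace = (F * (C * diagonal (fun i => ((b i : ℝ) : ℂ)))).trace := by
      conv_lhs => rw [eB]
      rw [hF, hC]
      simp only [Matrix.mul_assoc]
      rw [← Matrix.mul_assoc U Uᴴ, hUU, Matrix.one_mul, Matrix.trace_mul_comm Vᴴ]
      simp only [Matrix.mul_assoc]
    rw [e1, e2, ← Matrix.trace_sub, ← Matrix.mul_sub, Matrix.trace]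
    refine Finset.sum_congr rfl fun j _ => ?_
    rw [Matrix.diag_apply, Matrix.mul_apply]
    refine Finset.sum_congr rfl fun i _ => ?_
    rw [Matrix.sub_apply, Matrix.diagonal_mul, Matrix.mul_diagonal]
    push_cast
    ring
  -- Factoring `a - b` as `(√a + √b) * (√a - √b)` lets Cauchy–Schwarz separate the measurement,
  -- bounded by `4` in total, from the Hellinger sum.
  have hN : |(E.mat * A).trace.re - (E.mat * B).trace.re| ≤
      ∑ p : ι × ι, (‖F p.2 p.1‖ * (√(a p.1) + √(b p.2))) *
        (‖C p.1 p.2‖ * |√(a p.1) - √(b p.2)|) := by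
    rw [← Complex.sub_re, hT, Finset.sum_comm, ← Fintype.sum_prod_type']
    refine (Complex.abs_re_le_norm _).trans ((norm_sum_le _ _).trans
      (Finset.sum_le_sum fun p _ => le_of_eq ?_))
    rw [norm_mul, norm_mul, Complex.norm_real, Real.norm_eq_abs]
    have e : a p.1 - b p.2 = (√(a p.1) + √(b p.2)) * (√(a p.1) - √(b p.2)) := by
      nlinarith [Real.sq_sqrt (ha0 p.1), Real.sq_sqrt (hb0 p.2)]
    rw [e, abs_mul, abs_of_nonneg (a := √(a p.1) + √(b p.2)) (by positivity)]
    ring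
  have hCS := Finset.sum_mul_sq_le_sq_mul_sq Finset.univ
    (fun p : ι × ι => ‖F p.2 p.1‖ * (√(a p.1) + √(b p.2)))
    (fun p : ι × ι => ‖C p.1 p.2‖ * |√(a p.1) - √(b p.2)|)
  have hX : ∑ p : ι × ι, (‖F p.2 p.1‖ * (√(a p.1) + √(b p.2))) ^ 2 ≤ 4 := by
    calc _ ≤ ∑ p : ι × ι, (2 * (a p.1 * Complex.normSq (F p.2 p.1)) +
          2 * (b p.2 * Complex.normSq (F p.2 p.1))) := by
          refine Finset.sum_le_sum fun p _ => ?_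
          rw [mul_pow, Complex.normSq_eq_norm_sq]
          have : (√(a p.1) + √(b p.2)) ^ 2 ≤ 2 * (a p.1 + b p.2) := by
            nlinarith [Real.sq_sqrt (ha0 p.1), Real.sq_sqrt (hb0 p.2),
              sq_nonneg (√(a p.1) - √(b p.2))]
          nlinarith [mul_le_mul_of_nonneg_left this (sq_nonneg ‖F p.2 p.1‖)]
      _ = 2 * (∑ i, ∑ j, a i * Complex.normSq (F j i)) +
          2 * (∑ j, ∑ i, b j * Complex.normSq (F j i)) := by
          rw [Finset.sum_add_distrib, ← Finset.mul_sum, ← Finset.mul_sum, Fintype.sum_prod_type,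
            Fintype.sum_prod_type_right]
      _ ≤ 4 := by linarith
  have hY : ∑ p : ι × ι, (‖C p.1 p.2‖ * |√(a p.1) - √(b p.2)|) ^ 2 =
      ∑ i, ∑ j, o i j * (√(a i) - √(b j)) ^ 2 := by
    rw [Fintype.sum_prod_type]
    refine Finset.sum_congr rfl fun i _ => Finset.sum_congr rfl fun j _ => ?_
    rw [mul_pow, sq_abs, ← Complex.normSq_eq_norm_sq]
    rfl
  have hY0 : 0 ≤ ∑ i, ∑ j, o i j * (√(a i) - √(b j)) ^ 2 := by
    rw [← hY]
    positivity
  calc _ = |(E.mat * A).trace.re - (E.mat * B).trace.re| ^ 2 := (sq_abs _).symm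
    _ ≤ _ := pow_le_pow_left₀ (abs_nonneg _) hN 2
    _ ≤ _ := hCS
    _ ≤ 4 * ∑ i, ∑ j, o i j * (√(a i) - √(b j)) ^ 2 := by
        rw [hY]
        exact mul_le_mul_of_nonneg_right hX hY0
    _ ≤ _ := by linarith

/-- If `A ≤ K B`, then the relative entropy of `A` with respect to `B` is at most `log K`. -/
theorem relEntropy_le_log {A B : Matrix ι ι ℂ} (hA : A.PosSemidef) (hB : B.PosDef)
    (hA1 : A.trace.re = 1) {K : ℝ} (hK : 0 < K) (h : ((K : ℂ) • B - A).PosSemidef) :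
    relEntropy hA.isHermitian hB.isHermitian ≤ Real.log K := by
  set U : Matrix ι ι ℂ := eigU hA.isHermitian with hU
  set V : Matrix ι ι ℂ := eigU hB.isHermitian with hV
  set a := hA.isHermitian.eigenvalues with ha
  set b := hB.isHermitian.eigenvalues with hb
  set o := overlap hA.isHermitian hB.isHermitian with ho
  have ha0 : ∀ i, 0 ≤ a i := hA.eigenvalues_nonneg
  have hb0 : ∀ i, 0 < b i := hB.eigenvalues_pos
  have ho0 : ∀ i j, 0 ≤ o i j := overlap_nonneg _ _
  have eA : A = U * diagonal (fun i => ((a i : ℝ) : ℂ)) * Uᴴ := (specFun_id hA.isHermitian).symm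
  have eB : B = V * diagonal (fun i => ((b i : ℝ) : ℂ)) * Vᴴ := (specFun_id hB.isHermitian).symm
  have hVV' : Vᴴ * V = 1 := conjTranspose_eigU_mul _
  set q : ι → ℝ := fun i => ∑ j, (b j)⁻¹ * o i j with hq
  have hq0 : ∀ i, 0 ≤ q i := fun i =>
    Finset.sum_nonneg fun j _ => mul_nonneg (inv_nonneg.mpr (hb0 j).le) (ho0 i j)
  -- `q i` is the expectation of `B⁻¹` in the `i`-th eigenvector `u` of `A`. Testing `K • B - A` on
  -- `B⁻¹ u` gives `a i * q i ^ 2 ≤ K * q i`; operator monotonicity of the logarithm is not needed.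
  have hqa : ∀ i, a i * q i ≤ K := by
    intro i
    set Q : Matrix ι ι ℂ := (Uᴴ * V) * diagonal (fun j => (((b j)⁻¹ : ℝ) : ℂ)) * (Uᴴ * V)ᴴ with hQ
    set Y : Matrix ι ι ℂ := V * diagonal (fun j => (((b j)⁻¹ : ℝ) : ℂ)) * Vᴴ * U with hY
    have hdH : (diagonal (fun j => (((b j)⁻¹ : ℝ) : ℂ)))ᴴ =
        diagonal (fun j => (((b j)⁻¹ : ℝ) : ℂ)) := by
      rw [Matrix.diagonal_conjTranspose]
      congr 1
      ext j
      simp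
    have hUY : Uᴴ * Y = Q := by
      rw [hY, hQ]
      simp only [Matrix.conjTranspose_mul, Matrix.conjTranspose_conjTranspose, Matrix.mul_assoc]
    have hYB : Yᴴ * B * Y = Q := by
      have e : diagonal (fun i => ((b i : ℝ) : ℂ)) * diagonal (fun j => (((b j)⁻¹ : ℝ) : ℂ)) =
          1 := by
        rw [Matrix.diagonal_mul_diagonal, ← Matrix.diagonal_one]
        congr 1
        ext j
        rw [← Complex.ofReal_mul, mul_inv_cancel₀ (hb0 j).ne', Complex.ofReal_one]
      conv_lhs => rw [eB]
      rw [hY, hQ]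
      simp only [Matrix.conjTranspose_mul, Matrix.conjTranspose_conjTranspose, Matrix.mul_assoc,
        hdH]
      rw [← Matrix.mul_assoc Vᴴ V, hVV', Matrix.one_mul, ← Matrix.mul_assoc Vᴴ V, hVV',
        Matrix.one_mul, ← Matrix.mul_assoc (diagonal fun i => ((b i : ℝ) : ℂ)), e, Matrix.one_mul]
    have hYA : Yᴴ * A * Y = Qᴴ * diagonal (fun i => ((a i : ℝ) : ℂ)) * Qᴴᴴ := by
      conv_lhs => rw [eA]
      rw [← hUY]
      simp only [Matrix.conjTranspose_mul, Matrix.conjTranspose_conjTranspose, Matrix.mul_assoc]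
    have hQi : Q i i = (q i : ℂ) := mul_diagonal_mul_conjTranspose_apply (Uᴴ * V) _ i
    have h1 := (h.conjTranspose_mul_mul_same Y).diag_nonneg (i := i)
    rw [Matrix.mul_sub, Matrix.sub_mul, Matrix.mul_smul, Matrix.smul_mul, hYB, hYA,
      Matrix.sub_apply, Matrix.smul_apply, hQi, mul_diagonal_mul_conjTranspose_apply,
      smul_eq_mul, ← Complex.ofReal_mul, ← Complex.ofReal_sub] at h1
    have h2 : 0 ≤ K * q i - ∑ l, a l * Complex.normSq (Qᴴ i l) := by exact_mod_cast h1
    have h3 : a i * Complex.normSq (Qᴴ i i) ≤ ∑ l, a l * Complex.normSq (Qᴴ i l) :=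
      Finset.single_le_sum (f := fun l => a l * Complex.normSq (Qᴴ i l))
        (fun l _ => mul_nonneg (ha0 l) (Complex.normSq_nonneg _)) (Finset.mem_univ i)
    rw [Matrix.conjTranspose_apply, hQi, ← starRingEnd_apply, Complex.normSq_conj,
      Complex.normSq_ofReal] at h3
    rcases (hq0 i).eq_or_lt with h0 | h0
    · rw [← h0, mul_zero]
      exact hK.le
    · refine le_of_mul_le_mul_right ?_ h0
      linarith
  have hsum := trace_re_eq_sum_left hA.isHermitian hB.isHermitian
  rw [hA1] at hsum
  have hsum' : ∑ i, a i = 1 := by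
    rw [hsum]
    refine Finset.sum_congr rfl fun i _ => ?_
    rw [← Finset.mul_sum, overlap_sum_right, mul_one]
  rw [relEntropy_eq_sum]
  calc _ ≤ ∑ i, ∑ j, (a i * (a i / K) * ((b j)⁻¹ * o i j) + (Real.log K - 1) * (a i * o i j)) := by
        refine Finset.sum_le_sum fun i _ => Finset.sum_le_sum fun j _ => ?_
        change o i j * (a i * Real.log (a i) - a i * Real.log (b j)) ≤ _
        rcases (ha0 i).eq_or_lt with h0 | h0
        · simp [← h0]
        have h1 := Real.log_le_sub_one_of_pos (x := a i / (K * b j))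
          (div_pos h0 (mul_pos hK (hb0 j)))
        rw [Real.log_div h0.ne' (mul_pos hK (hb0 j)).ne', Real.log_mul hK.ne' (hb0 j).ne'] at h1
        have h2 := mul_le_mul_of_nonneg_left h1 (mul_nonneg (ho0 i j) h0.le)
        have e : a i / (K * b j) = (a i / K) * (b j)⁻¹ := by
          rw [div_mul_eq_div_div, div_eq_mul_inv (a i / K)]
        rw [e] at h2
        nlinarith
    _ = (∑ i, a i * (a i * q i / K)) + (Real.log K - 1) * ∑ i, ∑ j, a i * o i j := by
        simp_rw [Finset.sum_add_distrib, ← Finset.mul_sum]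
        congr 1
        refine Finset.sum_congr rfl fun i _ => ?_
        change _ * q i = _
        ring
    _ ≤ (∑ i, a i * 1) + (Real.log K - 1) * 1 := by
        rw [← hsum]
        refine add_le_add_left (Finset.sum_le_sum fun i _ => ?_) _
        exact mul_le_mul_of_nonneg_left ((div_le_one hK).mpr (hqa i)) (ha0 i)
    _ = Real.log K := by
        simp only [mul_one, hsum']
        ring

end Spectral

/-! ### Learning a state by minimizing relative entropy -/

section Learning

variable {ι : Type} [Fintype ι]

/-- The equal mixture of two states. -/
def DensityMatrix.midpoint (ρ ω : DensityMatrix ι) : DensityMatrix ι where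
  mat := (2⁻¹ : ℂ) • (ρ.mat + ω.mat)
  posSemidef := (ρ.posSemidef.add ω.posSemidef).smul (by
    rw [Complex.le_def]; norm_num)
  trace_eq_one := by
    rw [Matrix.trace_smul, Matrix.trace_add, ρ.trace_eq_one, ω.trace_eq_one, smul_eq_mul]
    norm_num

theorem trace_midpoint_mul_re (ρ ω : DensityMatrix ι) (L : Matrix ι ι ℂ) :
    ((ρ.midpoint ω).mat * L).trace.re = ((ρ.mat * L).trace.re + (ω.mat * L).trace.re) / 2 := by
  unfold DensityMatrix.midpoint
  rw [Matrix.smul_mul, Matrix.add_mul, Matrix.trace_smul, Matrix.trace_add, smul_eq_mul]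
  have : (2⁻¹ : ℂ) = ((2⁻¹ : ℝ) : ℂ) := by push_cast; rfl
  rw [this, Complex.re_ofReal_mul, Complex.add_re]
  ring

theorem DensityMatrix.trace_re (ρ : DensityMatrix ι) : ρ.mat.trace.re = 1 := by
  rw [ρ.trace_eq_one, Complex.one_re]

variable [DecidableEq ι]

theorem relEntropy_nonneg {A B : Matrix ι ι ℂ} (hA : A.PosSemidef) (hB : B.PosDef)
    (h : A.trace.re = B.trace.re) : 0 ≤ relEntropy hA.isHermitian hB.isHermitian := by
  rw [trace_re_eq_sum_left hA.isHermitian hB.isHermitian,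
    trace_re_eq_sum_right hA.isHermitian hB.isHermitian] at h
  have key : 0 ≤ ∑ i, ∑ j, (overlap hA.isHermitian hB.isHermitian i j *
      (hA.isHermitian.eigenvalues i * Real.log (hA.isHermitian.eigenvalues i) -
        hA.isHermitian.eigenvalues i * Real.log (hB.isHermitian.eigenvalues j)) -
      (hA.isHermitian.eigenvalues i * overlap hA.isHermitian hB.isHermitian i j -
        hB.isHermitian.eigenvalues j * overlap hA.isHermitian hB.isHermitian i j)) := by
    refine Finset.sum_nonneg fun i _ => Finset.sum_nonneg fun j _ => ?_
    have h1 := sq_sqrt_sub_sqrt_le (hA.eigenvalues_nonneg i) (hB.eigenvalues_pos j)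
    have h2 := mul_nonneg (overlap_nonneg hA.isHermitian hB.isHermitian i j)
      ((sq_nonneg _).trans h1)
    linarith
  simp only [Finset.sum_sub_distrib] at key
  rw [relEntropy_eq_sum]
  simp only [mul_sub, Finset.sum_sub_distrib] at key ⊢
  linarith

theorem Effect.prob_midpoint (E : Effect ι) (ρ ω : DensityMatrix ι) :
    E.prob (ρ.midpoint ω) = (E.prob ρ + E.prob ω) / 2 := by
  unfold Effect.prob DensityMatrix.midpoint
  rw [Matrix.mul_smul, Matrix.mul_add, Matrix.trace_smul, Matrix.trace_add, smul_eq_mul]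
  have : (2⁻¹ : ℂ) = ((2⁻¹ : ℝ) : ℂ) := by push_cast; rfl
  rw [this, Complex.re_ofReal_mul, Complex.add_re]
  ring

/-- The relative entropy of two states. -/
def DensityMatrix.relEnt (ρ τ : DensityMatrix ι) : ℝ :=
  relEntropy ρ.posSemidef.isHermitian τ.posSemidef.isHermitian

/-- The defect of convexity is exactly the mean of the relative entropies of `ρ` and `ω` to their
midpoint. Each is at least `1/4` of the square of half the probability gap, which gives the `16`;
the support condition holds because twice the midpoint dominates both states. -/
theorem relEnt_midpoint_add_le (E : Effect ι) (ρ ω τ : DensityMatrix ι) :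
    (ρ.midpoint ω).relEnt τ + (E.prob ρ - E.prob ω) ^ 2 / 16 ≤
      (ρ.relEnt τ + ω.relEnt τ) / 2 := by
  set m := ρ.midpoint ω with hm
  have e2 : ((2 : ℝ) : ℂ) • m.mat = ρ.mat + ω.mat := by
    rw [hm, DensityMatrix.midpoint, smul_smul]
    norm_num
  have h1 := sq_trace_effect_le_relEntropy E ρ.posSemidef m.posSemidef ρ.trace_re m.trace_re
    (c := 2) (by rw [e2, add_sub_cancel_left]; exact ω.posSemidef)
  have h2 := sq_trace_effect_le_relEntropy E ω.posSemidef m.posSemidef ω.trace_re m.trace_re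
    (c := 2) (by rw [e2, add_sub_cancel_right]; exact ρ.posSemidef)
  change (E.prob ρ - E.prob m) ^ 2 ≤ _ at h1
  change (E.prob ω - E.prob m) ^ 2 ≤ _ at h2
  rw [hm, Effect.prob_midpoint, ← hm] at h1 h2
  have h3 := trace_midpoint_mul_re ρ ω (specFun m.posSemidef.isHermitian Real.log)
  have h4 := trace_midpoint_mul_re ρ ω (specFun τ.posSemidef.isHermitian Real.log)
  rw [← hm] at h3 h4
  unfold DensityMatrix.relEnt
  unfold relEntropy at *
  rw [← negEntropy_eq_trace] at h3
  nlinarith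

/-- A list of constraints `(y, s)` on states: the effect `E y` has probability at least `2/3` if `s`
is true, and at most `1/3` otherwise. -/
def Consistent {Y : Type} (E : Y → Effect ι) (L : List (Y × Bool)) (ω : DensityMatrix ι) : Prop :=
  ∀ c ∈ L, (c.2 = true → 2 / 3 ≤ (E c.1).prob ω) ∧ (c.2 = false → (E c.1).prob ω ≤ 1 / 3)

/-- Each constraint in the list is violated by the hypothesis formed from the previous ones. -/
def Informative {Y : Type} (E : Y → Effect ι) (h : List (Y × Bool) → DensityMatrix ι) :
    List (Y × Bool) → Prop
  | [] => True
  | c :: L => Informative E h L ∧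
      (c.2 = true → (E c.1).prob (h L) < 1 / 2) ∧ (c.2 = false → 1 / 2 ≤ (E c.1).prob (h L))

/-- A slack `η` replaces the compactness argument for an exact minimizer. The state `τ` is a dummy
value for unsatisfiable constraints. -/
theorem exists_near_minimizer {Y : Type} (E : Y → Effect ι) (τ : DensityMatrix ι)
    (hτ : τ.mat.PosDef) {η : ℝ} (hη : 0 < η) (L : List (Y × Bool)) :
    ∃ h : DensityMatrix ι, ∀ ω, Consistent E L ω →
      Consistent E L h ∧ h.relEnt τ ≤ ω.relEnt τ + η := by
  by_cases hne : ∃ ω, Consistent E L ω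
  · obtain ⟨ω₀, hω₀⟩ := hne
    set S : Set ℝ := (fun ω : DensityMatrix ι => ω.relEnt τ) '' {ω | Consistent E L ω} with hS
    have hbdd : BddBelow S := by
      refine ⟨0, ?_⟩
      rintro _ ⟨ω, _, rfl⟩
      exact relEntropy_nonneg ω.posSemidef hτ (ω.trace_re.trans τ.trace_re.symm)
    obtain ⟨_, ⟨h, hh, rfl⟩, hlt⟩ := exists_lt_of_csInf_lt (⟨_, ω₀, hω₀, rfl⟩ : S.Nonempty)
      (lt_add_of_pos_right (sInf S) hη)
    refine ⟨h, fun ω hω => ⟨hh, ?_⟩⟩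
    have := csInf_le hbdd (⟨ω, hω, rfl⟩ : ω.relEnt τ ∈ S)
    exact hlt.le.trans (by linarith)
  · push Not at hne
    exact ⟨τ, fun ω hω => (hne ω hω).elim⟩

theorem Consistent.midpoint {Y : Type} {E : Y → Effect ι} {L : List (Y × Bool)}
    {ρ ω : DensityMatrix ι} (hρ : Consistent E L ρ) (hω : Consistent E L ω) :
    Consistent E L (ρ.midpoint ω) := by
  intro c hc
  rw [Effect.prob_midpoint]
  refine ⟨fun hs => ?_, fun hs => ?_⟩
  · linarith [(hρ c hc).1 hs, (hω c hc).1 hs]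
  · linarith [(hρ c hc).2 hs, (hω c hc).2 hs]

/-- If `ω` obeys the new constraint and `h L` violates it, their midpoint is still admissible for
`L` and has relative entropy well below the average. Near-minimality of `h L` then puts it at least
`1/576` below `ω`, and induction applies to `h L`. -/
theorem length_le_of_informative {Y : Type} (E : Y → Effect ι) (τ : DensityMatrix ι)
    (hτ : τ.mat.PosDef) (h : List (Y × Bool) → DensityMatrix ι)
    (hh : ∀ L ω, Consistent E L ω →
      Consistent E L (h L) ∧ (h L).relEnt τ ≤ ω.relEnt τ + 1 / 1152)
    (L : List (Y × Bool)) (hL : Informative E h L) (ω : DensityMatrix ι) (hω : Consistent E L ω) :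
    (L.length : ℝ) / 576 ≤ ω.relEnt τ := by
  induction L generalizing ω with
  | nil =>
    rw [List.length_nil, Nat.cast_zero, zero_div]
    exact relEntropy_nonneg ω.posSemidef hτ (ω.trace_re.trans τ.trace_re.symm)
  | cons c L ih =>
    have hωL : Consistent E L ω := fun d hd => hω d (List.mem_cons_of_mem _ hd)
    obtain ⟨h1, -⟩ := hh L ω hωL
    have h3 := ih hL.1 _ h1
    have h4 := (hh L _ (hωL.midpoint h1)).2
    have h5 := relEnt_midpoint_add_le (E c.1) ω (h L) τ
    have h6 := hω c List.mem_cons_self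
    have h7 := hL.2
    -- The gap `2/3 - 1/2` is `1/6`, and `(1/6) ^ 2 / 16 = 1/576`. The slack `1/1152` consumes half
    -- of this, and solving for `ω.relEnt τ` doubles the rest.
    have h8 : 1 / 36 ≤ ((E c.1).prob ω - (E c.1).prob (h L)) ^ 2 := by
      cases hc : c.2
      · have := h6.2 hc
        have := h7.2 hc
        nlinarith
      · have := h6.1 hc
        have := h7.1 hc
        nlinarith
    rw [List.length_cons]
    push_cast
    linarith

/-- Finitely many classical hypotheses suffice to describe all states dominated by `K τ`, as far as
the effects `E y` with probability outside `(1/3, 2/3)` are concerned. -/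
theorem exists_hypotheses {Y : Type} [Fintype Y] (E : Y → Effect ι) (τ : DensityMatrix ι)
    (hτ : τ.mat.PosDef) {K : ℝ} (hK : 0 < K) (M : ℕ) (hM : 576 * Real.log K ≤ M) :
    ∃ H : Finset (Y → Bool), H.card ≤ (2 * Fintype.card Y + 1) ^ M ∧
      ∀ ρ : DensityMatrix ι, ((K : ℂ) • τ.mat - ρ.mat).PosSemidef →
        ∃ g ∈ H, ∀ y, (2 / 3 ≤ (E y).prob ρ → g y = true) ∧
          ((E y).prob ρ ≤ 1 / 3 → g y = false) := by
  classical
  choose h hh using exists_near_minimizer E τ hτ (η := 1 / 1152) (by norm_num)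
  let guess : List (Y × Bool) → Y → Bool := fun L y => decide (1 / 2 ≤ (E y).prob (h L))
  -- Padding with `none` encodes all lists of length at most `M` by functions on `Fin M`.
  let dec : (Fin M → Option (Y × Bool)) → Y → Bool :=
    fun v => guess ((List.ofFn v).reduceOption)
  refine ⟨Finset.univ.image dec, ?_, fun ρ hρ => ?_⟩
  · refine Finset.card_image_le.trans (le_of_eq ?_)
    rw [Finset.card_univ, Fintype.card_fun, Fintype.card_fin, Fintype.card_option,
      Fintype.card_prod, Fintype.card_bool, mul_comm 2]
  have hlen : ∀ L, Informative E h L ∧ Consistent E L ρ → L.length ≤ M := by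
    rintro L ⟨h1, h2⟩
    have h3 := length_le_of_informative E τ hτ h hh L h1 ρ h2
    have h4 := relEntropy_le_log ρ.posSemidef hτ ρ.trace_re hK hρ
    have h5 : (L.length : ℝ) ≤ M := by
      change ρ.relEnt τ ≤ _ at h4
      linarith
    exact_mod_cast h5
  -- For a longest informative list consistent with `ρ`, the guess agrees with `ρ` on every `y`
  -- outside the gap; a disagreement would extend the list.
  obtain ⟨L, hL, hmax⟩ : ∃ L, (Informative E h L ∧ Consistent E L ρ) ∧
      ∀ L', Informative E h L' ∧ Consistent E L' ρ → L'.length ≤ L.length := by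
    let P : ℕ → Prop := fun m => ∃ L, (Informative E h L ∧ Consistent E L ρ) ∧ L.length = m
    have hP0 : P 0 := ⟨[], ⟨trivial, fun c hc => by simp at hc⟩, rfl⟩
    obtain ⟨L, hL, hLm⟩ := Nat.findGreatest_spec (P := P) (Nat.zero_le M) hP0
    exact ⟨L, hL, fun L' hL' => hLm ▸ Nat.le_findGreatest (hlen L' hL') ⟨L', hL', rfl⟩⟩
  refine ⟨guess L, Finset.mem_image.mpr ⟨fun i => L[(i : ℕ)]?, Finset.mem_univ _, ?_⟩, fun y => ?_⟩
  · change guess _ = guess L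
    congr 1
    have hLM := hlen L hL
    have e : List.ofFn (fun i : Fin M => L[(i : ℕ)]?) =
        L.map some ++ List.replicate (M - L.length) none := by
      apply List.ext_getElem?
      intro i
      rw [List.getElem?_ofFn, List.getElem?_append, List.length_map]
      by_cases hi : i < L.length
      · simp [hi, hi.trans_le hLM]
      · rw [if_neg hi, List.getElem?_replicate]
        by_cases hiM : i < M
        · rw [dif_pos hiM, if_pos (by omega), List.getElem?_eq_none (not_lt.mp hi)]
        · rw [dif_neg hiM, if_neg (by omega)]
    rw [e, List.reduceOption_append]
    simp [List.reduceOption]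
  · have hstep : ∀ s : Bool, ¬ (((s = true → (E y).prob (h L) < 1 / 2) ∧
        (s = false → 1 / 2 ≤ (E y).prob (h L))) ∧
        ((s = true → 2 / 3 ≤ (E y).prob ρ) ∧ (s = false → (E y).prob ρ ≤ 1 / 3))) := by
      rintro s ⟨h1, h2⟩
      have := hmax ((y, s) :: L) ⟨⟨hL.1, h1⟩, fun c hc => by
        rcases List.mem_cons.mp hc with rfl | hc
        · exact h2
        · exact hL.2 c hc⟩
      simp at this
    refine ⟨fun hy => ?_, fun hy => ?_⟩
    · by_contra hg
      have hg' : ¬ 1 / 2 ≤ (E y).prob (h L) := fun h' => hg (decide_eq_true h')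
      exact hstep true ⟨⟨fun _ => not_le.mp hg', nofun⟩, fun _ => hy, nofun⟩
    · by_contra hg
      have hg' : 1 / 2 ≤ (E y).prob (h L) := by
        by_contra h'
        exact hg (decide_eq_false h')
      exact hstep false ⟨⟨nofun, fun _ => hg'⟩, nofun, fun _ => hy⟩

end Learning

/-! ### Bob's states are dominated by a fixed state -/

section Domination

variable {α β κ : Type} [Fintype α] [DecidableEq α] [Fintype β] [DecidableEq β] [Fintype κ]

/-- The partial trace over the first half of a bipartite system. -/
def partialTrace (M : Matrix (α × β) (α × β) ℂ) : Matrix β β ℂ :=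
  Matrix.of fun b b' => ∑ j, M (j, b) (j, b')

/-- No-signalling: by trace preservation, an operation on Alice's half leaves Bob's marginal
unchanged. -/
theorem partialTrace_tensorId_apply (Φ : Channel α κ) (ρ : DensityMatrix (α × β)) :
    partialTrace ((Φ.tensorId β).apply ρ).mat = partialTrace ρ.mat := by
  ext b b'
  have e : ∀ i j, ((Φ.kraus i ⊗ₖ (1 : Matrix β β ℂ)) * ρ.mat *
      (Φ.kraus i ⊗ₖ (1 : Matrix β β ℂ))ᴴ) (j, b) (j, b') =
      ∑ x', ∑ x, star (Φ.kraus i j x') * Φ.kraus i j x * ρ.mat (x, b) (x', b') := by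
    intro i j
    simp only [Matrix.mul_apply, Fintype.sum_prod_type, Matrix.kroneckerMap_apply,
      Matrix.conjTranspose_apply, Matrix.one_apply, mul_ite, ite_mul, mul_one, mul_zero, zero_mul,
      Finset.sum_ite_eq, Finset.mem_univ, if_true, star_zero, apply_ite star]
    refine Finset.sum_congr rfl fun x' _ => ?_
    rw [Finset.sum_mul]
    exact Finset.sum_congr rfl fun x _ => by ring
  have h1 : ∀ x' x, ∑ i, ∑ j, star (Φ.kraus i j x') * Φ.kraus i j x =
      (1 : Matrix α α ℂ) x' x := by
    intro x' x
    rw [← Φ.sum_eq_one, Matrix.sum_apply]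
    rfl
  change ∑ j, (∑ i, (Φ.kraus i ⊗ₖ (1 : Matrix β β ℂ)) * ρ.mat *
      (Φ.kraus i ⊗ₖ (1 : Matrix β β ℂ))ᴴ) (j, b) (j, b') = ∑ j, ρ.mat (j, b) (j, b')
  simp_rw [Matrix.sum_apply, e]
  calc _ = ∑ x', ∑ x, (∑ i, ∑ j, star (Φ.kraus i j x') * Φ.kraus i j x) *
        ρ.mat (x, b) (x', b') := by
        rw [Finset.sum_comm]
        simp_rw [Finset.sum_mul]
        rw [Finset.sum_congr rfl fun i _ => Finset.sum_comm, Finset.sum_comm]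
        refine Finset.sum_congr rfl fun x' _ => ?_
        rw [Finset.sum_congr rfl fun i _ => Finset.sum_comm, Finset.sum_comm]
    _ = _ := by
        simp_rw [h1, Matrix.one_apply]
        simp

variable [DecidableEq κ]

/-- Splitting a vector along the first factor of a bipartite system loses at most the dimension of
that factor in any positive quadratic form. -/
theorem posSemidef_card_smul_sub {M : Matrix (κ × β) (κ × β) ℂ} (hM : M.PosSemidef) :
    (((Fintype.card κ : ℝ) : ℂ) • ((1 : Matrix κ κ ℂ) ⊗ₖ partialTrace M) - M).PosSemidef := by
  have hD : ∀ j l : κ, (diagonal (fun p : κ × β => (if p.1 = j then 1 else 0) -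
      (if p.1 = l then 1 else 0) : κ × β → ℂ))ᴴ = diagonal (fun p : κ × β =>
      (if p.1 = j then 1 else 0) - (if p.1 = l then 1 else 0)) := fun j l => by
    rw [Matrix.diagonal_conjTranspose]
    congr 1
    ext p
    simp [apply_ite star]
  -- With `P j` the block projections and `d` the dimension of `κ`, half of this sum is `d * ∑ j, P
  -- j * M * P j - M`, a pinching inequality. Adding `d` times the off-diagonal part `h2` completes
  -- the pinched matrix to `1 ⊗ₖ partialTrace M`.
  have h1 : (∑ j : κ, ∑ l : κ, diagonal (fun p : κ × β => (if p.1 = j then 1 else 0) -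
      (if p.1 = l then 1 else 0) : κ × β → ℂ) * M * diagonal (fun p : κ × β =>
      (if p.1 = j then 1 else 0) - (if p.1 = l then 1 else 0))).PosSemidef :=
    Matrix.posSemidef_sum _ fun j _ => Matrix.posSemidef_sum _ fun l _ => by
      have := hM.mul_mul_conjTranspose_same (diagonal (fun p : κ × β =>
        (if p.1 = j then 1 else 0) - (if p.1 = l then 1 else 0) : κ × β → ℂ))
      rwa [hD] at this
  have h2 : (∑ j : κ, ∑ i ∈ Finset.univ.erase j, (Matrix.single j i (1 : ℂ) ⊗ₖ (1 : Matrix β β ℂ)) *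
      M * (Matrix.single j i (1 : ℂ) ⊗ₖ (1 : Matrix β β ℂ))ᴴ).PosSemidef :=
    Matrix.posSemidef_sum _ fun j _ => Matrix.posSemidef_sum _ fun i _ =>
      hM.mul_mul_conjTranspose_same _
  have h3 := (h1.smul (a := (2⁻¹ : ℂ)) (by rw [Complex.le_def]; norm_num)).add
    (h2.smul (a := ((Fintype.card κ : ℝ) : ℂ)) (by
      rw [Complex.ofReal_natCast]; exact Nat.cast_nonneg _))
  convert h3 using 1
  ext ⟨x, b⟩ ⟨x', b'⟩
  have e1 : ∀ j i, ((Matrix.single j i (1 : ℂ) ⊗ₖ (1 : Matrix β β ℂ)) *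
      M * (Matrix.single j i (1 : ℂ) ⊗ₖ (1 : Matrix β β ℂ))ᴴ) (x, b) (x', b') =
      if x = j ∧ x' = j then M (i, b) (i, b') else 0 := by
    intro j i
    simp only [Matrix.mul_apply, Fintype.sum_prod_type, Matrix.kroneckerMap_apply,
      Matrix.conjTranspose_apply, Matrix.one_apply, mul_ite, ite_mul, mul_one, mul_zero, zero_mul,
      Finset.sum_ite_eq, Finset.mem_univ, if_true, star_zero, apply_ite star, Matrix.single_apply,
      star_one, ite_and, one_mul]
    by_cases h1 : x = j <;> by_cases h2 : x' = j <;> simp [h1, h2, eq_comm]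
  have e2 : ∑ j, ∑ l, (((if x = j then 1 else 0) - (if x = l then 1 else 0) : ℂ) *
      ((if x' = j then 1 else 0) - (if x' = l then 1 else 0))) =
      2 * Fintype.card κ * (if x = x' then 1 else 0) - 2 := by
    simp only [mul_sub, Finset.sum_sub_distrib, mul_ite, mul_one, mul_zero, Finset.sum_ite_eq,
      Finset.sum_const, Finset.card_univ, nsmul_eq_mul, Finset.mem_univ, if_true]
    by_cases h : x = x' <;> simp [h] <;> ring
  have e3 : ∑ j, ∑ l, ((((if x = j then 1 else 0) - (if x = l then 1 else 0) : ℂ) *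
      M (x, b) (x', b')) * ((if x' = j then 1 else 0) - (if x' = l then 1 else 0))) =
      (2 * Fintype.card κ * (if x = x' then 1 else 0) - 2) * M (x, b) (x', b') := by
    rw [← e2]
    simp_rw [Finset.sum_mul]
    exact Finset.sum_congr rfl fun j _ => Finset.sum_congr rfl fun l _ => by ring
  simp only [Matrix.sub_apply, Matrix.add_apply, Matrix.smul_apply, Matrix.sum_apply, e1,
    Matrix.diagonal_mul, Matrix.mul_diagonal, Matrix.kroneckerMap_apply, Matrix.one_apply, e3,
    partialTrace, Matrix.of_apply, smul_eq_mul, Complex.ofReal_natCast]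
  by_cases h : x = x'
  · subst h
    simp only [and_self, if_true]
    have e4 : ∑ j : κ, ∑ i ∈ Finset.univ.erase j, (if x = j then M (i, b) (i, b') else 0) =
        ∑ i, M (i, b) (i, b') - M (x, b) (x, b') := by
      rw [Finset.sum_eq_single x (fun j _ hj => by simp [hj.symm]) (by simp)]
      simp only [if_true]
      rw [← Finset.sum_erase_add _ _ (Finset.mem_univ x), add_sub_cancel_right]
    rw [e4]
    ring
  · have h' : ∀ j, ¬ (x = j ∧ x' = j) := fun j hj => h (hj.1.trans hj.2.symm)
    simp only [h, h', if_false, Finset.sum_const_zero]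
    ring

/-- The state of the second half of a bipartite system, next to a maximally mixed register. -/
def mixedTensorMarginal (κ : Type) [Fintype κ] [DecidableEq κ] [Nonempty κ]
    (ρ : DensityMatrix (α × β)) : DensityMatrix (κ × β) where
  mat := ((Fintype.card κ : ℝ)⁻¹ : ℂ) • ((1 : Matrix κ κ ℂ) ⊗ₖ partialTrace ρ.mat)
  posSemidef := by
    refine Matrix.PosSemidef.smul ?_ (by
      rw [Complex.ofReal_natCast]; exact inv_nonneg.mpr (Nat.cast_nonneg _))
    refine Matrix.PosSemidef.one.kronecker ?_
    have e : partialTrace ρ.mat = ∑ j, ρ.mat.submatrix (fun b => (j, b)) (fun b => (j, b)) := by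
      ext b b'
      simp [partialTrace, Matrix.sum_apply]
    rw [e]
    exact Matrix.posSemidef_sum _ fun j _ => ρ.posSemidef.submatrix _
  trace_eq_one := by
    have e : (partialTrace ρ.mat).trace = 1 := by
      rw [← ρ.trace_eq_one, Matrix.trace, Matrix.trace, Fintype.sum_prod_type, Finset.sum_comm]
      rfl
    rw [Matrix.trace_smul, Matrix.trace_kronecker, e, Matrix.trace_one, smul_eq_mul, mul_one,
      Complex.ofReal_natCast, inv_mul_cancel₀]
    exact_mod_cast Fintype.card_ne_zero

/-- A message adds at most a factor `dim²` to the receiver's prior knowledge. -/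
theorem tensorId_apply_le [Nonempty κ] (Φ : Channel α κ) (ρ : DensityMatrix (α × β)) :
    ((((Fintype.card κ : ℝ) ^ 2 : ℝ) : ℂ) • (mixedTensorMarginal κ ρ).mat -
      ((Φ.tensorId β).apply ρ).mat).PosSemidef := by
  have h := posSemidef_card_smul_sub ((Φ.tensorId β).apply ρ).posSemidef
  rw [partialTrace_tensorId_apply] at h
  convert h using 2
  rw [mixedTensorMarginal, smul_smul]
  congr 1
  have : (Fintype.card κ : ℂ) ≠ 0 := by exact_mod_cast Fintype.card_ne_zero
  push_cast
  field_simp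

end Domination

/-! ### Full-rank reference states -/

section FullRank

variable {ι : Type} [Fintype ι] [DecidableEq ι]

/-- Every state is dominated by twice a state of full rank. -/
theorem exists_posDef_dominating (σ : DensityMatrix ι) :
    ∃ τ : DensityMatrix ι, τ.mat.PosDef ∧ (((2 : ℝ) : ℂ) • τ.mat - σ.mat).PosSemidef := by
  have hne : Nonempty ι := by
    by_contra h
    rw [not_nonempty_iff] at h
    have := σ.trace_eq_one
    simp [Matrix.trace] at this
  have hc : (0 : ℝ) < Fintype.card ι := by exact_mod_cast Fintype.card_pos
  have hc' : (0 : ℂ) < ((Fintype.card ι : ℝ)⁻¹ : ℝ) := by exact_mod_cast inv_pos.mpr hc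
  let μ : DensityMatrix ι :=
    { mat := (((Fintype.card ι : ℝ)⁻¹ : ℝ) : ℂ) • 1
      posSemidef := Matrix.PosSemidef.one.smul hc'.le
      trace_eq_one := by
        rw [Matrix.trace_smul, Matrix.trace_one, smul_eq_mul, ← Complex.ofReal_natCast,
          ← Complex.ofReal_mul, inv_mul_cancel₀ hc.ne', Complex.ofReal_one] }
  have hμ : μ.mat.PosDef := Matrix.PosDef.one.smul hc'
  refine ⟨σ.midpoint μ, ?_, ?_⟩
  · exact (Matrix.PosDef.posSemidef_add σ.posSemidef hμ).smul (by rw [Complex.lt_def]; norm_num)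
  · have e : ((2 : ℝ) : ℂ) • (σ.midpoint μ).mat = σ.mat + μ.mat := by
      rw [DensityMatrix.midpoint, smul_smul]
      norm_num
    rw [e, add_sub_cancel_left]
    exact μ.posSemidef

theorem posSemidef_smul_sub_trans {ι : Type} {A B C : Matrix ι ι ℂ} {a b : ℝ} (ha : 0 ≤ a)
    (h1 : ((a : ℂ) • B - A).PosSemidef) (h2 : ((b : ℂ) • C - B).PosSemidef) :
    (((a * b : ℝ) : ℂ) • C - A).PosSemidef := by
  have h := h1.add (h2.smul (a := (a : ℂ)) (by exact_mod_cast ha))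
  convert h using 1
  rw [smul_sub, smul_smul, Complex.ofReal_mul]
  abel

end FullRank

/-! ### Consequences for QCMA protocols -/

section Protocol

variable {X Y : Type} {p a : ℕ}

/-- Bob's joint state in a QCMA protocol. -/
def QCMAProtocol.state (P : QCMAProtocol X Y p a) (x : X) (w : Fin p → Bool) :
    DensityMatrix (Qubits a × Fin P.dimB) :=
  ((P.alice x w).tensorId (Fin P.dimB)).apply P.shared

theorem QCMAProtocol.state_le (P : QCMAProtocol X Y p a) (x : X) (w : Fin p → Bool) :
    ((((4 : ℝ) ^ a : ℝ) : ℂ) • (mixedTensorMarginal (Qubits a) P.shared).mat -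
      (P.state x w).mat).PosSemidef := by
  have h := tensorId_apply_le (P.alice x w) P.shared
  have e : ((Fintype.card (Qubits a) : ℝ)) ^ 2 = 4 ^ a := by
    simp [← pow_mul, mul_comm a]
    norm_num [pow_mul]
  rwa [e] at h

/-- The classical description of all the messages of a QCMA protocol. -/
theorem QCMAProtocol.exists_hypotheses [Fintype Y] (P : QCMAProtocol X Y p a) (M : ℕ)
    (hM : 576 * Real.log (4 ^ a * 2) ≤ M) :
    ∃ H : Finset (Y → Bool), H.card ≤ (2 * Fintype.card Y + 1) ^ M ∧
      ∀ x w, ∃ g ∈ H, ∀ y, (2 / 3 ≤ P.acceptProb x y w → g y = true) ∧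
          (P.acceptProb x y w ≤ 1 / 3 → g y = false) := by
  obtain ⟨τ, hτ, h⟩ := exists_posDef_dominating (mixedTensorMarginal (Qubits a) P.shared)
  obtain ⟨H, hH, hH'⟩ := OneWay.exists_hypotheses P.bob τ hτ (K := 4 ^ a * 2) (by positivity) M hM
  exact ⟨H, hH, fun x w => hH' (P.state x w)
    (posSemidef_smul_sub_trans (by positivity) (P.state_le x w) h)⟩

/-- Without a message, Bob's acceptance probability cannot tell Alice's inputs apart. -/
theorem QCMAProtocol.acceptProb_le_of_no_message (P : QCMAProtocol X Y p 0) (x x' : X) (y : Y)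
    (w w' : Fin p → Bool) : P.acceptProb x y w ≤ P.acceptProb x' y w' := by
  set σ := mixedTensorMarginal (Qubits 0) P.shared with hσ
  -- With a message register of dimension one, `σ` dominates both states; testing the first on the
  -- effect and the second on its complement sandwiches `σ` between the two probabilities.
  have h1 := trace_mul_re_nonneg (P.bob y).posSemidef (P.state_le x w)
  have h2 := trace_mul_re_nonneg (P.bob y).posSemidef_one_sub (P.state_le x' w')
  rw [pow_zero, Complex.ofReal_one, one_smul, Matrix.mul_sub, Matrix.trace_sub, Complex.sub_re]
    at h1 h2
  rw [Matrix.sub_mul, Matrix.sub_mul, Matrix.trace_sub, Matrix.trace_sub, Matrix.one_mul,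
    Matrix.one_mul, Complex.sub_re, Complex.sub_re, DensityMatrix.trace_re,
    DensityMatrix.trace_re] at h2
  change ((P.bob y).mat * (P.state x w).mat).trace.re ≤
    ((P.bob y).mat * (P.state x' w').mat).trace.re
  linarith

end Protocol

/-! ### Subset counting, cores and a Chernoff bound -/

section Counting

theorem choose_mul_pow_le {t m : ℕ} (htm : t ≤ m) (h : ℕ) :
    t.choose h * m ^ h ≤ m.choose h * t ^ h := by
  have key : t.descFactorial h * m ^ h ≤ m.descFactorial h * t ^ h := by
    induction h with
    | zero => simp
    | succ h ih =>
      rw [Nat.descFactorial_succ, Nat.descFactorial_succ, pow_succ, pow_succ]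
      have h1 : (t - h) * m ≤ (m - h) * t := by
        rw [Nat.sub_mul, Nat.sub_mul, mul_comm m t]
        exact Nat.sub_le_sub_left (Nat.mul_le_mul_left h htm) _
      calc _ = (t - h) * m * (t.descFactorial h * m ^ h) := by ring
        _ ≤ (m - h) * t * (m.descFactorial h * t ^ h) := Nat.mul_le_mul h1 ih
        _ = _ := by ring
  rw [Nat.descFactorial_eq_factorial_mul_choose, Nat.descFactorial_eq_factorial_mul_choose,
    mul_assoc, mul_assoc] at key
  exact Nat.le_of_mul_le_mul_left key h.factorial_pos

variable {α : Type} [DecidableEq α]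

/-- Union bound: choose `h` elements of `I` inside `X ∩ T`, then the others. -/
theorem card_filter_le_card_inter (X T : Finset α) (k h : ℕ) :
    ((X.powersetCard k).filter fun I => h ≤ (I ∩ T).card).card ≤
      (X ∩ T).card.choose h * (X.card - h).choose (k - h) := by
  have hsub : ((X.powersetCard k).filter fun I => h ≤ (I ∩ T).card) ⊆
      ((X ∩ T).powersetCard h).biUnion fun S =>
        ((X \ S).powersetCard (k - h)).image fun R => S ∪ R := by
    intro I hI
    rw [Finset.mem_filter, Finset.mem_powersetCard] at hI
    obtain ⟨⟨hIX, hIk⟩, hIT⟩ := hI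
    obtain ⟨S, hS, hSh⟩ := Finset.exists_subset_card_eq hIT
    have hSI : S ⊆ I := hS.trans Finset.inter_subset_left
    refine Finset.mem_biUnion.mpr ⟨S, Finset.mem_powersetCard.mpr
      ⟨hS.trans (Finset.inter_subset_inter_right hIX), hSh⟩,
      Finset.mem_image.mpr ⟨I \ S, Finset.mem_powersetCard.mpr
        ⟨Finset.sdiff_subset_sdiff hIX le_rfl, ?_⟩, Finset.union_sdiff_of_subset hSI⟩⟩
    rw [Finset.card_sdiff_of_subset hSI, hIk, hSh]
  refine (Finset.card_le_card hsub).trans ?_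
  rw [← Finset.card_powersetCard h (X ∩ T)]
  refine Finset.card_biUnion_le_card_mul _ _ _ fun S hS => Finset.card_image_le.trans ?_
  rw [Finset.mem_powersetCard] at hS
  rw [Finset.card_powersetCard,
    Finset.card_sdiff_of_subset (hS.1.trans Finset.inter_subset_left), hS.2]

/-- Density `1/16` costs a factor `16 ^ -h ≤ 4 ^ -k`; one `2 ^ k` pays for the choice of the `h`
elements within the `k`-set, the other is the gain. -/
theorem choose_mul_choose_mul_two_pow_le {t m k h : ℕ} (hh : 1 ≤ h) (hk : k ≤ 2 * h) (hhk : h ≤ k)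
    (htm : 16 * t ≤ m) : t.choose h * (m - h).choose (k - h) * 2 ^ k ≤ m.choose k := by
  have h1 : t.choose h * 16 ^ h ≤ m.choose h := by
    rcases Nat.eq_zero_or_pos t with rfl | ht
    · rw [Nat.choose_eq_zero_of_lt hh, zero_mul]
      exact Nat.zero_le _
    · refine Nat.le_of_mul_le_mul_right ?_ (pow_pos ht h)
      calc _ = t.choose h * (16 * t) ^ h := by rw [mul_pow]; ring
        _ ≤ t.choose h * m ^ h := Nat.mul_le_mul_left _ (Nat.pow_le_pow_left htm h)
        _ ≤ _ := choose_mul_pow_le (by omega) h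
  have h2 : 2 ^ k * 2 ^ k ≤ 16 ^ h := by
    rw [← pow_add, show 16 = 2 ^ 4 by norm_num, ← pow_mul]
    exact Nat.pow_le_pow_right (by norm_num) (by omega)
  have h3 := Nat.choose_mul (n := m) hhk
  have h4 : k.choose h ≤ 2 ^ k := Nat.choose_le_two_pow k h
  refine Nat.le_of_mul_le_mul_right ?_ (pow_pos (by norm_num : 0 < 2) k)
  calc _ = t.choose h * (2 ^ k * 2 ^ k) * (m - h).choose (k - h) := by ring
    _ ≤ t.choose h * 16 ^ h * (m - h).choose (k - h) := by gcongr
    _ ≤ m.choose h * (m - h).choose (k - h) := by gcongr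
    _ = m.choose k * k.choose h := h3.symm
    _ ≤ _ := by gcongr

/-- Few `k`-subsets of `X` have most of their elements in a small set `T`. -/
theorem card_filter_lt_two_mul_inter (X T : Finset α) {k : ℕ} (hk : 1 ≤ k)
    (hT : 16 * T.card ≤ X.card) :
    ((X.powersetCard k).filter fun I => k < 2 * (I ∩ T).card).card * 2 ^ k ≤ X.card.choose k := by
  have hsub : ((X.powersetCard k).filter fun I => k < 2 * (I ∩ T).card) ⊆
      (X.powersetCard k).filter fun I => (k + 1) / 2 ≤ (I ∩ T).card :=
    Finset.monotone_filter_right _ fun I _ => by omega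
  refine (Nat.mul_le_mul_right _ ((Finset.card_le_card hsub).trans
    (card_filter_le_card_inter X T k _))).trans ?_
  refine choose_mul_choose_mul_two_pow_le (by omega) (by omega) (by omega)
    ((Nat.mul_le_mul_left _ (Finset.card_le_card Finset.inter_subset_right)).trans hT)

/-- A set that meets most of every member of a family of `k`-sets, and is mostly contained in every
set that mostly contains each member of the family. -/
theorem exists_core [Fintype α] (G : Finset (Finset α)) {k : ℕ} (hk : 1 ≤ k)
    (hG : ∀ I ∈ G, I.card = k) :
    ∃ T : Finset α, (∀ X : Finset α, (∀ I ∈ G, 10 * (I \ X).card ≤ k) →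
        5 * (T \ X).card ≤ T.card) ∧ ∀ I ∈ G, k < 2 * (I ∩ T).card := by
  classical
  -- Take `T` of maximal size. A set `I` with at most half of its elements in `T` could be added: it
  -- contributes at least `k / 2` new elements, of which at most `k / 10`, a fifth, lie outside `X`.
  obtain ⟨T, hT, hmax⟩ := Finset.exists_max_image
    (Finset.univ.filter fun T : Finset α => ∀ X : Finset α,
      (∀ I ∈ G, 10 * (I \ X).card ≤ k) → 5 * (T \ X).card ≤ T.card) Finset.card
    ⟨∅, by simp⟩
  have hT' := (Finset.mem_filter.mp hT).2
  refine ⟨T, hT', fun I hI => ?_⟩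
  by_contra hcon
  have hIk := hG I hI
  have h1 : (I ∩ T).card + (I \ T).card = I.card := Finset.card_inter_add_card_sdiff I T
  have h2 : (T ∪ I).card = (I \ T).card + T.card := by
    rw [Finset.union_comm, Finset.card_sdiff_add_card]
  have h3 := hmax (T ∪ I) (Finset.mem_filter.mpr ⟨Finset.mem_univ _, fun X hX => by
    have h4 := hT' X hX
    have h5 := hX I hI
    have h6 : ((T ∪ I) \ X).card ≤ (T \ X).card + (I \ X).card := by
      rw [Finset.union_sdiff_distrib]
      exact Finset.card_union_le _ _
    omega⟩)
  omega

/-- The set of ones of a bit string. -/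
def ones {n : ℕ} (x : Fin n → Bool) : Finset (Fin n) := Finset.univ.filter fun i => x i = true

theorem card_filter_sdiff_ones_le {n : ℕ} (T : Finset (Fin n)) :
    (((Finset.univ.filter fun x : Fin n → Bool => 5 * (T \ ones x).card ≤ T.card).card : ℕ) : ℝ) ≤
      2 ^ n * (5 / 6) ^ T.card := by
  -- Exponential moment with weight `(3/4) ^ 5` per zero of `x` in `T`. Each position in `T`
  -- contributes `1 + (3/4) ^ 5 ≤ 2 * (5/8)`, the event has weight at least `(3/4) ^ T.card`, and
  -- `(5/8) / (3/4) = 5/6`.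
  set f : Fin n → Bool → ℝ := fun i b => if i ∈ T ∧ b = false then (3 / 4) ^ 5 else 1 with hf
  have h1 : ∑ x : Fin n → Bool, ∏ i, f i (x i) ≤ 2 ^ n * (5 / 8) ^ T.card := by
    have e := Finset.prod_univ_sum (fun _ : Fin n => (Finset.univ : Finset Bool)) f
    rw [Fintype.piFinset_univ] at e
    rw [← e]
    have e2 : (2 : ℝ) ^ n * (5 / 8) ^ T.card = ∏ i : Fin n, 2 * (if i ∈ T then 5 / 8 else 1) := by
      rw [Finset.prod_mul_distrib, Finset.prod_const, Finset.card_univ, Fintype.card_fin,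
        Finset.prod_ite_mem, Finset.univ_inter, Finset.prod_const]
    rw [e2]
    refine Finset.prod_le_prod (fun i _ => ?_) fun i _ => ?_
    · refine Finset.sum_nonneg fun b _ => ?_
      simp only [hf]
      split_ifs <;> positivity
    · rw [Fintype.sum_bool]
      by_cases h : i ∈ T <;> simp [hf, h] <;> norm_num
  have h2 : ∀ x : Fin n → Bool, ∏ i, f i (x i) = (3 / 4) ^ (5 * (T \ ones x).card) := by
    intro x
    have e : T \ ones x = Finset.univ.filter fun i => i ∈ T ∧ x i = false := by
      ext i
      simp [ones]
    rw [pow_mul, e, ← Finset.prod_const, Finset.prod_filter]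
  have h3 : (((Finset.univ.filter fun x : Fin n → Bool =>
      5 * (T \ ones x).card ≤ T.card).card : ℕ) : ℝ) * (3 / 4) ^ T.card ≤
      ∑ x : Fin n → Bool, ∏ i, f i (x i) := by
    rw [← nsmul_eq_mul]
    refine (Finset.card_nsmul_le_sum _ (fun x => ∏ i, f i (x i)) _ fun x hx => ?_).trans
      (Finset.sum_le_univ_sum_of_nonneg fun x => ?_)
    · rw [h2]
      exact pow_le_pow_of_le_one (by norm_num) (by norm_num) (Finset.mem_filter.mp hx).2
    · rw [h2]
      positivity
  refine le_of_mul_le_mul_right ((h3.trans h1).trans (le_of_eq ?_))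
    (by positivity : (0 : ℝ) < (3 / 4) ^ T.card)
  rw [mul_assoc, ← mul_pow]
  norm_num

/-- Complementation maps strings with fewer than `n / 2` ones injectively to the others. -/
theorem two_pow_le_two_mul_card_ones (n : ℕ) :
    2 ^ n ≤ 2 * (Finset.univ.filter fun x : Fin n → Bool => n ≤ 2 * (ones x).card).card := by
  have h1 := Finset.card_filter_add_card_filter_not (s := (Finset.univ : Finset (Fin n → Bool)))
    (fun x => n ≤ 2 * (ones x).card)
  have h2 : (Finset.univ.filter fun x : Fin n → Bool => ¬ n ≤ 2 * (ones x).card).card ≤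
      (Finset.univ.filter fun x : Fin n → Bool => n ≤ 2 * (ones x).card).card := by
    refine Finset.card_le_card_of_injOn (fun x i => !(x i)) (fun x hx => ?_) fun x _ y _ hxy => ?_
    · have hx' := (Finset.mem_filter.mp hx).2
      refine Finset.mem_coe.mpr (Finset.mem_filter.mpr ⟨Finset.mem_univ _, ?_⟩)
      have h3 := Finset.card_filter_add_card_filter_not (s := (Finset.univ : Finset (Fin n)))
        (fun i => x i = true)
      have h4 : ones (fun i => !(x i)) = Finset.univ.filter fun i => ¬ x i = true := by
        ext i
        simp [ones]
      rw [Finset.card_univ, Fintype.card_fin, ← h4] at h3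
      change n ≤ 2 * (ones fun i => !(x i)).card
      change (ones x).card + _ = n at h3
      omega
    · ext i
      have := congrFun hxy i
      simpa using this
  rw [Finset.card_univ, Fintype.card_fun, Fintype.card_bool, Fintype.card_fin] at h1
  omega

end Counting

/-! ### The QCMA lower bound -/

section LowerBound

variable {n : ℕ}

theorem majIx_eq_true_iff (x : Fin n → Bool) (I : {I : Finset (Fin n) // I.card = Nat.sqrt n}) :
    majIx n x I = some true ↔ I.1 ⊆ ones x := by
  have h : (I.1.filter fun i => x i = true).card = Nat.sqrt n ↔ I.1 ⊆ ones x := by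
    have h := Finset.card_filter_eq_iff (s := I.1) (p := fun i => x i = true)
    rw [I.2] at h
    rw [h]
    simp [Finset.subset_iff, ones]
  rw [← h]
  unfold majIx
  split_ifs with h1 h2 <;> simp [h1]

theorem majIx_eq_false_of_lt (x : Fin n → Bool) (I : {I : Finset (Fin n) // I.card = Nat.sqrt n})
    (h : Nat.sqrt n < 10 * (I.1 \ ones x).card) : majIx n x I = some false := by
  have h1 := Finset.card_inter_add_card_sdiff I.1 (ones x)
  have h2 : (I.1.filter fun i => x i = true) = I.1 ∩ ones x := by
    ext i
    simp [ones]
  have h3 := I.2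
  unfold majIx
  rw [h2, if_neg (by omega), if_pos (by omega)]

/-- Some proof is good for a `2 ^ -p` fraction of the `1`-inputs of a given `x`. -/
theorem exists_popular_proof {α : Type} [DecidableEq α] (S : Finset α) {p : ℕ}
    (A : α → (Fin p → Bool) → Prop) (hA : ∀ I ∈ S, ∃ w, A I w) :
    ∃ w, ∃ F ⊆ S, (∀ I ∈ F, A I w) ∧ S.card ≤ 2 ^ p * F.card := by
  classical
  by_contra! hcon
  have h1 : S.card ≤ ∑ w, (S.filter fun I => A I w).card := by
    refine (Finset.card_le_card fun I hI => ?_).trans Finset.card_biUnion_le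
    obtain ⟨w, hw⟩ := hA I hI
    exact Finset.mem_biUnion.mpr ⟨w, Finset.mem_univ _, Finset.mem_filter.mpr ⟨hI, hw⟩⟩
  have h2 : ∑ w : Fin p → Bool, 2 ^ p * (S.filter fun I => A I w).card <
      ∑ _w : Fin p → Bool, S.card :=
    Finset.sum_lt_sum_of_nonempty Finset.univ_nonempty fun w _ =>
      hcon w _ (Finset.filter_subset _ _) fun I hI => (Finset.mem_filter.mp hI).2
  rw [← Finset.mul_sum, Finset.sum_const, Finset.card_univ, Fintype.card_fun, Fintype.card_bool,
    Fintype.card_fin, smul_eq_mul] at h2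
  exact absurd (Nat.mul_le_mul_left (2 ^ p) h1) (not_le.mpr h2)

/-- The core of `g` depends on `g` only, so each `g` can serve only strings that are mostly `1` on a
fixed large set; these must cover all strings with at least `n / 2` ones. -/
theorem two_pow_le_of_hypotheses {p : ℕ} (hn : 1 ≤ n) (hp : p < Nat.sqrt n)
    (H : Finset ({I : Finset (Fin n) // I.card = Nat.sqrt n} → Bool))
    (hH : ∀ x : Fin n → Bool, ∀ S : Finset {I : Finset (Fin n) // I.card = Nat.sqrt n},
      (∀ I ∈ S, majIx n x I = some true) → ∃ g ∈ H, ∃ F ⊆ S, (∀ I ∈ F, g I = true) ∧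
        S.card ≤ 2 ^ p * F.card ∧ ∀ I, majIx n x I = some false → g I = false) :
    (2 : ℝ) ^ n ≤ 2 * (H.card * (2 ^ n * (5 / 6 : ℝ) ^ ((n : ℝ) / 32))) := by
  classical
  have hk1 : 1 ≤ Nat.sqrt n := Nat.le_sqrt.mpr hn
  have hkn : Nat.sqrt n * Nat.sqrt n ≤ n := Nat.sqrt_le n
  let fam : ({I : Finset (Fin n) // I.card = Nat.sqrt n} → Bool) → Finset (Finset (Fin n)) :=
    fun g =>
    (Finset.univ.filter fun I => g I = true).image Subtype.val
  have hfam : ∀ g, ∀ I ∈ fam g, I.card = Nat.sqrt n := by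
    intro g I hI
    obtain ⟨J, -, rfl⟩ := Finset.mem_image.mp hI
    exact J.2
  choose T hT1 hT2 using fun g => exists_core (fam g) hk1 (hfam g)
  let bad : ({I : Finset (Fin n) // I.card = Nat.sqrt n} → Bool) → Finset (Fin n → Bool) := fun g =>
    if n ≤ 32 * (T g).card then
      Finset.univ.filter fun x : Fin n → Bool => 5 * (T g \ ones x).card ≤ (T g).card
    else ∅
  have hbad : ∀ g, ((bad g).card : ℝ) ≤ 2 ^ n * (5 / 6 : ℝ) ^ ((n : ℝ) / 32) := by
    intro g
    simp only [bad]
    split_ifs with h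
    · refine (card_filter_sdiff_ones_le (T g)).trans ?_
      refine mul_le_mul_of_nonneg_left ?_ (by positivity)
      rw [← Real.rpow_natCast]
      refine Real.rpow_le_rpow_of_exponent_ge (by norm_num) (by norm_num) ?_
      rw [div_le_iff₀ (by norm_num), mul_comm]
      exact_mod_cast h
    · rw [Finset.card_empty, Nat.cast_zero]
      positivity
  have hcover : (Finset.univ.filter fun x : Fin n → Bool => n ≤ 2 * (ones x).card) ⊆
      H.biUnion bad := by
    intro x hx
    have hx' : n ≤ 2 * (ones x).card := (Finset.mem_filter.mp hx).2
    obtain ⟨g, hg, F, hF, hFg, hcard, hg0⟩ := hH x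
      (Finset.univ.filter fun I => I.1 ⊆ ones x)
      fun I hI => (majIx_eq_true_iff x I).mpr (Finset.mem_filter.mp hI).2
    refine Finset.mem_biUnion.mpr ⟨g, hg, ?_⟩
    have hTx : 5 * (T g \ ones x).card ≤ (T g).card := by
      refine hT1 g _ fun I hI => ?_
      obtain ⟨J, hJ, rfl⟩ := Finset.mem_image.mp hI
      by_contra hcon
      have h0 := hg0 J (majIx_eq_false_of_lt x J (not_le.mp hcon))
      rw [(Finset.mem_filter.mp hJ).2] at h0
      exact Bool.noConfusion h0
    -- Otherwise `T g` has at most `1/16` of the size of `ones x`, and `F` would be both at least a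
    -- `2 ^ -p` and at most a `2 ^ -k` fraction of the `k`-sets of ones.
    have hlarge : n ≤ 32 * (T g).card := by
      by_contra hsmall
      have h1 := card_filter_lt_two_mul_inter (ones x) (T g) hk1 (by omega)
      have h2 : F.card ≤ (((ones x).powersetCard (Nat.sqrt n)).filter fun I =>
          Nat.sqrt n < 2 * (I ∩ T g).card).card := by
        rw [← Finset.card_image_of_injective F Subtype.val_injective]
        refine Finset.card_le_card fun I hI => ?_
        obtain ⟨J, hJ, rfl⟩ := Finset.mem_image.mp hI
        refine Finset.mem_filter.mpr ⟨Finset.mem_powersetCard.mpr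
          ⟨(Finset.mem_filter.mp (hF hJ)).2, J.2⟩, hT2 g _ (Finset.mem_image.mpr
          ⟨J, Finset.mem_filter.mpr ⟨Finset.mem_univ _, hFg J hJ⟩, rfl⟩)⟩
      have h3 : (ones x).card.choose (Nat.sqrt n) ≤ (Finset.univ.filter
          fun I : {I : Finset (Fin n) // I.card = Nat.sqrt n} => I.1 ⊆ ones x).card := by
        rw [← Finset.card_powersetCard, ← Finset.card_image_of_injective _ Subtype.val_injective]
        refine Finset.card_le_card fun I hI => ?_
        obtain ⟨hI1, hI2⟩ := Finset.mem_powersetCard.mp hI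
        exact Finset.mem_image.mpr ⟨⟨I, hI2⟩, Finset.mem_filter.mpr ⟨Finset.mem_univ _, hI1⟩, rfl⟩
      have hkm : Nat.sqrt n ≤ (ones x).card := by
        rcases Nat.lt_or_ge (Nat.sqrt n) 2 with h | h
        · omega
        · nlinarith
      have h4 := Nat.choose_pos hkm
      have h5 : 0 < F.card := by
        by_contra h0
        rw [Nat.eq_zero_of_not_pos h0] at hcard
        omega
      have h6 : 2 ^ (Nat.sqrt n) * F.card ≤ 2 ^ p * F.card := by
        calc 2 ^ (Nat.sqrt n) * F.card ≤ _ := Nat.mul_le_mul_left _ h2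
          _ ≤ _ := by rw [mul_comm]; exact h1
          _ ≤ _ := h3.trans hcard
      have h7 := Nat.le_of_mul_le_mul_right h6 h5
      exact absurd h7 (not_le.mpr (Nat.pow_lt_pow_right (by norm_num) hp))
    simp only [bad, if_pos hlarge]
    exact Finset.mem_filter.mpr ⟨Finset.mem_univ _, hTx⟩
  have h1 : (Finset.univ.filter fun x : Fin n → Bool => n ≤ 2 * (ones x).card).card ≤
      ∑ g ∈ H, (bad g).card := (Finset.card_le_card hcover).trans Finset.card_biUnion_le
  have h2 := (two_pow_le_two_mul_card_ones n).trans (Nat.mul_le_mul_left 2 h1)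
  have h3 : (2 : ℝ) ^ n ≤ 2 * ∑ g ∈ H, ((bad g).card : ℝ) := by exact_mod_cast h2
  refine h3.trans (mul_le_mul_of_nonneg_left ?_ (by norm_num))
  rw [← nsmul_eq_mul]
  exact Finset.sum_le_card_nsmul _ _ _ fun g _ => hbad g

theorem one_half_le_log {n : ℕ} (hn : 2 ≤ n) : 1 / 2 ≤ Real.log n := by
  have h1 : Real.log 2 ≤ Real.log n := Real.log_le_log (by norm_num) (by exact_mod_cast hn)
  linarith [Real.log_two_gt_d9]

/-- The analytic form of the counting bound. -/
theorem sqrt_le_of_two_pow_le {a M N h : ℕ} (hn : 2 ≤ n) (hN : N = n.choose (Nat.sqrt n))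
    (hM : (M : ℝ) ≤ 576 * Real.log (4 ^ a * 2) + 1) (hh : h ≤ (2 * N + 1) ^ M)
    (H : (2 : ℝ) ^ n ≤ 2 * (h * (2 ^ n * (5 / 6 : ℝ) ^ ((n : ℝ) / 32)))) :
    Real.sqrt n ≤ 700000 * (a + 1) * Real.log n := by
  set k := Nat.sqrt n with hk
  have hk1 : 1 ≤ k := Nat.le_sqrt.mpr (by omega)
  have hlog := one_half_le_log hn
  have hn0 : (0 : ℝ) < n := by exact_mod_cast (by omega : 0 < n)
  have hkr : (k : ℝ) ≤ Real.sqrt n := by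
    apply Real.le_sqrt_of_sq_le
    rw [sq]
    exact_mod_cast Nat.sqrt_le n
  have hs1 : (1 : ℝ) ≤ Real.sqrt n := le_trans (by exact_mod_cast hk1) hkr
  have hM' : (M : ℝ) ≤ 1154 * (a + 1) := by
    have e : Real.log (4 ^ a * 2) = (2 * a + 1) * Real.log 2 := by
      rw [Real.log_mul (by positivity) (by norm_num), Real.log_pow,
        show (4 : ℝ) = 2 ^ 2 by norm_num, Real.log_pow]
      push_cast
      ring
    rw [e] at hM
    have h1 : (2 * (a : ℝ) + 1) * Real.log 2 ≤ (2 * a + 1) * 1 :=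
      mul_le_mul_of_nonneg_left (by linarith [Real.log_two_lt_d9]) (by positivity)
    linarith
  have hNle : Real.log (2 * N + 1) ≤ 3 * Real.sqrt n * Real.log n := by
    have h1 : 2 * N + 1 ≤ n ^ (k + 2) := by
      have h2 : N ≤ n ^ k := hN ▸ Nat.choose_le_pow n k
      have h3 : 1 ≤ n ^ k := Nat.one_le_pow _ _ (by omega)
      have h4 : 4 ≤ n ^ 2 := by nlinarith
      rw [pow_add]
      nlinarith
    have h2 : ((2 * N + 1 : ℕ) : ℝ) ≤ ((n ^ (k + 2) : ℕ) : ℝ) := by exact_mod_cast h1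
    push_cast at h2
    refine (Real.log_le_log (by positivity) h2).trans ?_
    rw [Real.log_pow]
    refine mul_le_mul_of_nonneg_right ?_ (by linarith)
    push_cast
    linarith
  have hh' : (h : ℝ) ≤ (2 * N + 1) ^ M := by exact_mod_cast hh
  have hB : (0 : ℝ) < (5 / 6 : ℝ) ^ ((n : ℝ) / 32) := by positivity
  have H1 : (1 : ℝ) ≤ 2 * ((2 * N + 1) ^ M * (5 / 6 : ℝ) ^ ((n : ℝ) / 32)) := by
    have h2n : (0 : ℝ) < 2 ^ n := by positivity
    refine le_of_mul_le_mul_right ?_ h2n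
    rw [one_mul]
    refine H.trans ?_
    have := mul_le_mul_of_nonneg_right hh' (mul_pos h2n hB).le
    nlinarith
  have H2 := Real.log_le_log one_pos H1
  rw [Real.log_one, Real.log_mul (by norm_num) (by positivity),
    Real.log_mul (by positivity) hB.ne', Real.log_pow, Real.log_rpow (by norm_num)] at H2
  have h56 : Real.log (5 / 6) ≤ -(1 / 6) := by
    have := Real.log_le_sub_one_of_pos (x := 5 / 6) (by norm_num)
    linarith
  have h1 : (n : ℝ) / 32 * Real.log (5 / 6) ≤ (n : ℝ) / 32 * -(1 / 6) :=
    mul_le_mul_of_nonneg_left h56 (by positivity)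
  have h2 : (M : ℝ) * Real.log (2 * N + 1) ≤ 1154 * (a + 1) * (3 * Real.sqrt n * Real.log n) :=
    mul_le_mul hM' hNle (Real.log_nonneg (by linarith [(Nat.cast_nonneg N : (0 : ℝ) ≤ N)]))
      (by positivity)
  have h3 : (1 : ℝ) ≤ 2 * (Real.sqrt n * Real.log n) := by nlinarith
  have h4 : Real.sqrt n * Real.log n ≤ (a + 1) * (Real.sqrt n * Real.log n) :=
    le_mul_of_one_le_left (by linarith) (by linarith [(Nat.cast_nonneg a : (0 : ℝ) ≤ a)])
  -- Up to the `log 2` term, `n / 192` is at most `1154 * 3` times the product; `192 * 3464 <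
  -- 700000`.
  have h5 : (n : ℝ) ≤ 700000 * ((a + 1) * (Real.sqrt n * Real.log n)) := by
    linarith [Real.log_two_lt_d9]
  have h6 : Real.sqrt n * Real.sqrt n = n := Real.mul_self_sqrt hn0.le
  refine le_of_mul_le_mul_left ?_ (by linarith : (0 : ℝ) < Real.sqrt n)
  rw [h6]
  linarith

theorem QCMAProtocol.sqrt_le {p a : ℕ} (hn : 2 ≤ n)
    (P : QCMAProtocol (Fin n → Bool) {I : Finset (Fin n) // I.card = Nat.sqrt n} p a)
    (hP : P.Computes (majIx n)) :
    Real.sqrt n ≤ 700000 * ((p + a + 1 : ℕ) : ℝ) * Real.log n := by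
  have hlog := one_half_le_log hn
  rcases Nat.lt_or_ge p (Nat.sqrt n) with hp | hp
  · obtain ⟨H, hH, hH'⟩ := P.exists_hypotheses ⌈576 * Real.log (4 ^ a * 2)⌉₊ (Nat.le_ceil _)
    have h0 : 0 ≤ 576 * Real.log (4 ^ a * 2) := by
      refine mul_nonneg (by norm_num) (Real.log_nonneg ?_)
      have : (1 : ℝ) ≤ 4 ^ a := one_le_pow₀ (by norm_num)
      linarith
    have h1 := sqrt_le_of_two_pow_le hn rfl (Nat.ceil_lt_add_one h0).le
      (by rwa [Fintype.card_finset_len, Fintype.card_fin] at hH)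
      (two_pow_le_of_hypotheses (by omega) hp H fun x S hS => ?_)
    · refine h1.trans ?_
      push_cast
      have : (0 : ℝ) ≤ p * Real.log n := by positivity
      nlinarith
    · obtain ⟨w, F, hF, hFw, hcard⟩ := exists_popular_proof S
        (fun I w => 2 / 3 ≤ P.acceptProb x I w) fun I hI => (hP x I).1 (hS I hI)
      obtain ⟨g, hg, hgw⟩ := hH' x w
      refine ⟨g, hg, F, hF, fun I hI => (hgw I).1 (hFw I hI), hcard, fun I hI => (hgw I).2 ?_⟩
      linarith [(hP x I).2 hI w]
  · have h1 : Real.sqrt n ≤ ((p + a + 1 : ℕ) : ℝ) := by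
      rw [Real.sqrt_le_left (by positivity)]
      have h2 : n ≤ (p + a + 1) ^ 2 := by
        have := Nat.sqrt_lt'.mp (lt_of_le_of_lt hp (by omega : p < p + a + 1))
        exact this.le
      exact_mod_cast h2
    nlinarith [(Nat.cast_nonneg (p + a + 1) : (0 : ℝ) ≤ ((p + a + 1 : ℕ) : ℝ))]

theorem QCMAProtocol.one_le_cost {p a : ℕ} (hn : 2 ≤ n)
    (P : QCMAProtocol (Fin n → Bool) {I : Finset (Fin n) // I.card = Nat.sqrt n} p a)
    (hP : P.Computes (majIx n)) : 1 ≤ p + a := by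
  by_contra hcon
  obtain ⟨rfl, rfl⟩ : p = 0 ∧ a = 0 := by omega
  obtain ⟨I, -, hI⟩ := Finset.exists_subset_card_eq
    (s := (Finset.univ : Finset (Fin n))) (n := Nat.sqrt n) (by
      rw [Finset.card_univ, Fintype.card_fin]
      exact Nat.sqrt_le_self n)
  have hk1 : 1 ≤ Nat.sqrt n := Nat.le_sqrt.mpr (by omega)
  obtain ⟨w, hw⟩ := (hP (fun _ => true) ⟨I, hI⟩).1
    ((majIx_eq_true_iff _ _).mpr (by simp [ones]))
  have h0 := (hP (fun _ => false) ⟨I, hI⟩).2 (majIx_eq_false_of_lt _ _ (by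
    simp [ones, hI]
    omega)) w
  have := P.acceptProb_le_of_no_message (fun _ => true) (fun _ => false) ⟨I, hI⟩ w w
  linarith

theorem qcmaEntComplexity_majIx_ge (hn : 2 ≤ n) :
    ENNReal.ofReal (1 / 1400000 * (Real.sqrt n / Real.log n)) ≤
      (qcmaEntComplexity (majIx n) : ℝ≥0∞) := by
  have hlog := one_half_le_log hn
  have key : ((⌈1 / 1400000 * (Real.sqrt n / Real.log n)⌉₊ : ℕ) : ℕ∞) ≤
      qcmaEntComplexity (majIx n) := by
    unfold qcmaEntComplexity
    refine le_iInf fun p => le_iInf fun a => le_iInf fun P => le_iInf fun hP => ?_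
    have h1 := P.sqrt_le hn hP
    -- A positive cost absorbs the `+ 1` in `sqrt_le`, doubling the constant to `1400000`.
    have h2 := P.one_le_cost hn hP
    refine Nat.cast_le.mpr (Nat.ceil_le.mpr ?_)
    have h3 : (1 : ℝ) ≤ ((p + a : ℕ) : ℝ) := by exact_mod_cast h2
    rw [Nat.cast_add (p + a), Nat.cast_one] at h1
    have h4 : Real.sqrt n / Real.log n ≤ 700000 * (((p + a : ℕ) : ℝ) + 1) :=
      (div_le_iff₀ (by linarith)).mpr h1
    linarith
  have h5 : ENNReal.ofReal (1 / 1400000 * (Real.sqrt n / Real.log n)) ≤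
      ((⌈1 / 1400000 * (Real.sqrt n / Real.log n)⌉₊ : ℕ) : ℝ≥0∞) := by
    rw [← ENNReal.ofReal_natCast]
    exact ENNReal.ofReal_le_ofReal (Nat.le_ceil _)
  refine h5.trans ?_
  rw [← ENat.toENNReal_coe]
  exact ENat.toENNReal_le.mpr key

end LowerBound

/-! ### The QMA protocol -/

section UpperBound

variable {ι : Type} [Fintype ι] [DecidableEq ι]

/-- The projection onto the uniform superposition of the basis states in `S`. -/
def uniformProj (S : Finset ι) : Matrix ι ι ℂ :=
  Matrix.of fun i j => if i ∈ S ∧ j ∈ S then (((S.card : ℝ)⁻¹ : ℝ) : ℂ) else 0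

theorem uniformProj_isHermitian {ι : Type} [DecidableEq ι] (S : Finset ι) :
    (uniformProj S).IsHermitian := by
  ext i j
  simp [uniformProj, Matrix.conjTranspose_apply, apply_ite star, and_comm]

theorem uniformProj_mul_self (S : Finset ι) : uniformProj S * uniformProj S = uniformProj S := by
  ext i j
  rw [Matrix.mul_apply]
  simp only [uniformProj, Matrix.of_apply]
  by_cases hi : i ∈ S
  · by_cases hj : j ∈ S
    · have hc : (S.card : ℂ) ≠ 0 := by
        exact_mod_cast (Finset.card_pos.mpr ⟨i, hi⟩).ne'
      simp only [hi, hj, true_and, and_true, if_true, ite_mul, mul_ite, zero_mul, mul_zero,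
        Finset.sum_ite_mem, Finset.univ_inter]
      simp [hc]
    · simp [hj]
  · simp [hi]

theorem uniformProj_posSemidef (S : Finset ι) : (uniformProj S).PosSemidef := by
  have h := Matrix.posSemidef_conjTranspose_mul_self (uniformProj S)
  rwa [(uniformProj_isHermitian S).eq, uniformProj_mul_self] at h

/-- The measurement that projects onto a uniform superposition. -/
def uniformEffect (S : Finset ι) : Effect ι where
  mat := uniformProj S
  posSemidef := uniformProj_posSemidef S
  posSemidef_one_sub := by
    have h := Matrix.posSemidef_conjTranspose_mul_self (1 - uniformProj S)
    rw [Matrix.conjTranspose_sub, Matrix.conjTranspose_one, (uniformProj_isHermitian S).eq,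
      Matrix.mul_sub, Matrix.mul_one, Matrix.sub_mul, uniformProj_mul_self, Matrix.one_mul,
      sub_self, sub_zero] at h
    exact h

theorem trace_uniformProj {S : Finset ι} (hS : S.Nonempty) : (uniformProj S).trace = 1 := by
  have hc : (S.card : ℂ) ≠ 0 := by exact_mod_cast hS.card_pos.ne'
  simp [Matrix.trace, uniformProj, hc]

/-- The uniform superposition of the basis states in `S`. -/
def uniformState (S : Finset ι) (hS : S.Nonempty) : DensityMatrix ι where
  mat := uniformProj S
  posSemidef := uniformProj_posSemidef S
  trace_eq_one := trace_uniformProj hS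

theorem Effect.prob_le_one (E : Effect ι) (ρ : DensityMatrix ι) : E.prob ρ ≤ 1 := by
  have h := trace_mul_re_nonneg E.posSemidef_one_sub ρ.posSemidef
  rw [Matrix.sub_mul, Matrix.trace_sub, Matrix.one_mul, Complex.sub_re, ρ.trace_re] at h
  exact sub_nonneg.mp h

/-- The Kraus operators of the channel that projects onto the basis states in `A`, and outputs the
basis state `r` if this fails. -/
def filterKraus (A : Finset ι) (r : ι) : Option ι → Matrix ι ι ℂ
  | none => diagonal fun i => if i ∈ A then 1 else 0
  | some j => if j ∈ A then 0 else Matrix.single r j 1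

theorem sum_filterKraus (A : Finset ι) (r : ι) :
    ∑ o, (filterKraus A r o)ᴴ * filterKraus A r o = 1 := by
  have h : ∀ j, (filterKraus A r (some j))ᴴ * filterKraus A r (some j) =
      if j ∈ A then 0 else Matrix.single j j 1 := by
    intro j
    by_cases hj : j ∈ A <;> simp [filterKraus, hj]
  rw [Fintype.sum_option]
  simp_rw [h]
  have e : (∑ j : ι, if j ∈ A then 0 else Matrix.single j j (1 : ℂ)) =
      diagonal fun i => if i ∈ A then 0 else 1 := by
    ext i l
    rw [Matrix.sum_apply]
    by_cases hil : i = l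
    · subst hil
      rw [Finset.sum_eq_single i]
      · by_cases hi : i ∈ A <;> simp [hi]
      · intro j _ hj
        by_cases hjA : j ∈ A <;> simp [hjA, hj]
      · simp
    · rw [Matrix.diagonal_apply_ne _ hil]
      refine Finset.sum_eq_zero fun j _ => ?_
      by_cases hjA : j ∈ A
      · simp [hjA]
      · rw [if_neg hjA, Matrix.single_apply, if_neg]
        rintro ⟨rfl, h⟩
        exact hil h
  rw [e, filterKraus, Matrix.diagonal_conjTranspose, Matrix.diagonal_mul_diagonal,
    Matrix.diagonal_add, ← Matrix.diagonal_one]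
  congr 2
  ext i
  by_cases hi : i ∈ A <;> simp [hi]

/-- The channel that projects onto the basis states in `A`, and outputs `r` if this fails. -/
def filterChannel (A : Finset ι) (r : ι) : Channel ι ι where
  num := Fintype.card (Option ι)
  kraus i := filterKraus A r ((Fintype.equivFin (Option ι)).symm i)
  sum_eq_one := by
    rw [Equiv.sum_comp (Fintype.equivFin (Option ι)).symm
      fun o => (filterKraus A r o)ᴴ * filterKraus A r o]
    exact sum_filterKraus A r

/-- The failure symbol `r` is orthogonal to Bob's superposition, so only the projection branch
counts. Restricting the uniform projector on `S` to `A` leaves the one on `A ∩ S`, with weight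
renormalized from `1 / S.card`. -/
theorem uniformEffect_prob_filterChannel (A S : Finset ι) {r : ι} (hr : r ∉ S)
    (ρ : DensityMatrix ι) : (uniformEffect S).prob ((filterChannel A r).apply ρ) =
      ((A ∩ S).card / S.card : ℝ) * (uniformEffect (A ∩ S)).prob ρ := by
  have h1 : uniformProj S * ((filterChannel A r).apply ρ).mat =
      uniformProj S * ((filterKraus A r none) * ρ.mat * (filterKraus A r none)ᴴ) := by
    change uniformProj S * ∑ i, filterKraus A r ((Fintype.equivFin (Option ι)).symm i) * ρ.mat *
      (filterKraus A r ((Fintype.equivFin (Option ι)).symm i))ᴴ = _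
    rw [Equiv.sum_comp (Fintype.equivFin (Option ι)).symm
      fun o => filterKraus A r o * ρ.mat * (filterKraus A r o)ᴴ, Fintype.sum_option,
      Matrix.mul_add, Finset.mul_sum, Finset.sum_eq_zero, add_zero]
    intro j _
    have h : uniformProj S * filterKraus A r (some j) = 0 := by
      by_cases hj : j ∈ A
      · rw [filterKraus, if_pos hj, Matrix.mul_zero]
      · rw [filterKraus, if_neg hj]
        ext i l
        rw [Matrix.mul_apply]
        refine Finset.sum_eq_zero fun q _ => ?_
        by_cases hq : q = r
        · subst hq
          simp [uniformProj, hr]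
        · rw [Matrix.single_apply, if_neg (fun h => hq h.1.symm), mul_zero]
    rw [← Matrix.mul_assoc, ← Matrix.mul_assoc, h, Matrix.zero_mul, Matrix.zero_mul]
  have h2 : (filterKraus A r none)ᴴ * uniformProj S * filterKraus A r none =
      (((A ∩ S).card / S.card : ℝ) : ℂ) • uniformProj (A ∩ S) := by
    ext i j
    rw [filterKraus, Matrix.diagonal_conjTranspose, Matrix.mul_diagonal, Matrix.diagonal_mul,
      Matrix.smul_apply, smul_eq_mul]
    simp only [uniformProj, Matrix.of_apply, Finset.mem_inter, Pi.star_apply]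
    by_cases hi : i ∈ A <;> by_cases hj : j ∈ A <;> by_cases hi' : i ∈ S <;>
      by_cases hj' : j ∈ S <;> simp only [hi, hj, hi', hj', and_true, and_false,
        if_true, if_false, mul_zero, zero_mul, star_one, star_zero, one_mul, mul_one]
    have hc : (((A ∩ S).card : ℕ) : ℂ) ≠ 0 := by
      exact_mod_cast (Finset.card_pos.mpr ⟨i, Finset.mem_inter.mpr ⟨hi, hi'⟩⟩).ne'
    push_cast
    field_simp
  change (uniformProj S * ((filterChannel A r).apply ρ).mat).trace.re =
    _ * (uniformProj (A ∩ S) * ρ.mat).trace.re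
  rw [h1, ← Complex.re_ofReal_mul, ← smul_eq_mul (((_ : ℝ) : ℂ)), ← Matrix.trace_smul,
    ← Matrix.smul_mul, ← h2]
  congr 1
  rw [← Matrix.mul_assoc, Matrix.trace_mul_comm]
  simp only [Matrix.mul_assoc]

variable {n m : ℕ}

/-- The basis states of the tuples of indices in `I`. -/
def tuples (e : Option (Fin 11 → Fin n) ↪ Qubits m) (I : Finset (Fin n)) : Finset (Qubits m) :=
  (Fintype.piFinset fun _ : Fin 11 => I).map (Function.Embedding.some.trans e)

theorem card_tuples (e : Option (Fin 11 → Fin n) ↪ Qubits m) (I : Finset (Fin n)) :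
    (tuples e I).card = I.card ^ 11 := by
  rw [tuples, Finset.card_map, Fintype.card_piFinset_const]

theorem tuples_inter (e : Option (Fin 11 → Fin n) ↪ Qubits m) (I J : Finset (Fin n)) :
    tuples e I ∩ tuples e J = tuples e (I ∩ J) := by
  rw [tuples, tuples, tuples, ← Finset.map_inter]
  congr 1
  ext v
  simp [Fintype.mem_piFinset, forall_and]

theorem reject_notMem_tuples (e : Option (Fin 11 → Fin n) ↪ Qubits m) (I : Finset (Fin n)) :
    e none ∉ tuples e I := by
  simp [tuples]

/-- Merlin sends eleven copies of the uniform superposition of the indices in Bob's set, Alice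
checks that the bits at these indices are all `1`, and Bob checks the superposition. -/
def majIxProtocol (e : Option (Fin 11 → Fin n) ↪ Qubits m) :
    QMAProtocol (Fin n → Bool) {I : Finset (Fin n) // I.card = Nat.sqrt n} m m where
  alice x := filterChannel (tuples e (ones x)) (e none)
  bob I := uniformEffect (tuples e I.1)

theorem majIxProtocol_acceptProb (e : Option (Fin 11 → Fin n) ↪ Qubits m) (x : Fin n → Bool)
    (I : {I : Finset (Fin n) // I.card = Nat.sqrt n}) (π : DensityMatrix (Qubits m)) :
    (majIxProtocol e).acceptProb x I π = (((ones x ∩ I.1).card : ℝ) / Nat.sqrt n) ^ 11 *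
      (uniformEffect (tuples e (ones x ∩ I.1))).prob π := by
  refine (uniformEffect_prob_filterChannel _ _ (reject_notMem_tuples e _) π).trans ?_
  rw [tuples_inter, card_tuples, card_tuples, I.2, div_pow]
  push_cast
  rfl

theorem ten_mul_card_le_of_majIx_eq_false (x : Fin n → Bool)
    (I : {I : Finset (Fin n) // I.card = Nat.sqrt n}) (h : majIx n x I = some false) :
    10 * (ones x ∩ I.1).card ≤ 9 * Nat.sqrt n := by
  have h2 : (I.1.filter fun i => x i = true) = ones x ∩ I.1 := by
    ext i
    simp [ones, and_comm]
  unfold majIx at h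
  rw [h2] at h
  split_ifs at h with h1 h3
  · simp at h
  · exact h3

theorem majIxProtocol_computes (hn : 1 ≤ n) (e : Option (Fin 11 → Fin n) ↪ Qubits m) :
    (majIxProtocol e).Computes (majIx n) := by
  intro x I
  have hk1 : 1 ≤ Nat.sqrt n := Nat.le_sqrt.mpr hn
  have hk : (0 : ℝ) < Nat.sqrt n := by exact_mod_cast hk1
  refine ⟨fun h => ?_, fun h π => ?_⟩
  · have hne : (tuples e I.1).Nonempty := by
      rw [← Finset.card_pos, card_tuples, I.2]
      positivity
    refine ⟨uniformState _ hne, ?_⟩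
    rw [majIx_eq_true_iff] at h
    rw [majIxProtocol_acceptProb, Finset.inter_eq_right.mpr h, I.2, div_self hk.ne', one_pow,
      one_mul]
    change 2 / 3 ≤ (uniformProj (tuples e I.1) * uniformProj (tuples e I.1)).trace.re
    rw [uniformProj_mul_self, trace_uniformProj hne]
    norm_num
  · have h1 := ten_mul_card_le_of_majIx_eq_false x I h
    have h2 : ((ones x ∩ I.1).card : ℝ) / Nat.sqrt n ≤ 9 / 10 := by
      rw [div_le_iff₀ hk]
      have : (10 : ℝ) * (ones x ∩ I.1).card ≤ 9 * Nat.sqrt n := by exact_mod_cast h1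
      linarith
    -- Eleven is the least exponent with `(9/10) ^ 11 ≤ 1/3`.
    have h3 : (majIxProtocol e).acceptProb x I π ≤ (9 / 10) ^ 11 * 1 := by
      rw [majIxProtocol_acceptProb]
      refine (mul_le_mul_of_nonneg_left (Effect.prob_le_one _ π) (by positivity)).trans ?_
      exact mul_le_mul_of_nonneg_right (pow_le_pow_left₀ (by positivity) h2 11) one_pos.le
    norm_num at h3 ⊢
    linarith

theorem qmaComplexity_majIx_le (hn : 2 ≤ n) :
    (qmaComplexity (majIx n) : ℝ≥0∞) ≤ ENNReal.ofReal (92 * Real.log n) := by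
  set l := Nat.log 2 n with hl
  -- Each index takes `l + 1` qubits; the extra qubit makes room for the failure symbol `none`.
  set m := 11 * (l + 1) + 1 with hm
  have hcard : Fintype.card (Option (Fin 11 → Fin n)) ≤ Fintype.card (Qubits m) := by
    rw [Fintype.card_option, Fintype.card_fun, Fintype.card_fin, Fintype.card_fin,
      Fintype.card_fun, Fintype.card_bool, Fintype.card_fin, hm, pow_succ 2, mul_comm 11, pow_mul]
    have h1 : n ^ 11 ≤ (2 ^ (l + 1)) ^ 11 :=
      Nat.pow_le_pow_left (Nat.lt_pow_succ_log_self (by norm_num) n).le 11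
    have h2 : 1 ≤ (2 ^ (l + 1)) ^ 11 := Nat.one_le_pow _ _ (by positivity)
    omega
  obtain ⟨e⟩ := Function.Embedding.nonempty_of_card_le hcard
  have h1 : qmaComplexity (majIx n) ≤ ((m + m : ℕ) : ℕ∞) :=
    iInf_le_of_le m (iInf_le_of_le m (iInf_le_of_le (majIxProtocol e)
      (iInf_le_of_le (majIxProtocol_computes (by omega) e) le_rfl)))
  refine (ENat.toENNReal_le.mpr h1).trans ?_
  rw [ENat.toENNReal_coe, ← ENNReal.ofReal_natCast]
  refine ENNReal.ofReal_le_ofReal ?_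
  have hlog := one_half_le_log hn
  have h2 : (l : ℝ) * Real.log 2 ≤ Real.log n := by
    rw [← Real.log_pow]
    refine Real.log_le_log (by positivity) ?_
    exact_mod_cast Nat.pow_log_le_self 2 (by omega)
  have h3 : (l : ℝ) * (1 / 2) ≤ l * Real.log 2 :=
    mul_le_mul_of_nonneg_left (by linarith [Real.log_two_gt_d9]) (Nat.cast_nonneg l)
  rw [hm]
  push_cast
  linarith

end UpperBound

end OneWay

end

theorem mainTheorem3 :
    (∃ C : ℝ, 0 < C ∧ ∀ n : ℕ, 2 ≤ n →
      (OneWay.qmaComplexity (OneWay.majIx n) : ℝ≥0∞) ≤ ENNReal.ofReal (C * Real.log n)) ∧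
    (∃ c : ℝ, 0 < c ∧ ∀ n : ℕ, 2 ≤ n →
      ENNReal.ofReal (c * (Real.sqrt n / Real.log n)) ≤
        (OneWay.qcmaEntComplexity (OneWay.majIx n) : ℝ≥0∞)) :=
  ⟨⟨92, by norm_num, fun _ hn => OneWay.qmaComplexity_majIx_le hn⟩,
    ⟨1 / 1400000, by norm_num, fun _ hn => OneWay.qcmaEntComplexity_majIx_ge hn⟩⟩
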